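/- Let $L$ be a finite-dimensional restricted Lie algebra, with $p$-mapping $x\mapsto x^{[p]}$, over an algebraically closed field $\mathbb{F}$ of characteristic $p>0$, $p\neq 2$. A restricted subalgebra is a subalgebra closed under $x\mapsto x^{[p]}$; for $A\subseteq L$ let $\langle A\rangle_p$ be the smallest restricted subalgebra of $L$ containing $A$, and let $A^{[p]}=\langle x^{[p]} : x\in A\rangle_p$. An element $x$ is semisimple if $x\in\langle x^{[p]}\rangle_p$, and $p$-nilpotent if $x^{[p]^n}=0$ for some $n>0$; a torus is an abelian restricted subalgebra consisting of semisimple elements. A restricted subalgebra $S$ is a restricted quasi-ideal of $L$ if $[S,K]\subseteq S+K$ for every restricted subalgebra $K$ of $L$. Suppose that every restricted subalgebra of $L$ is a restricted quasi-ideal of $L$. Then $L$ has a Cartan subalgebra $H$ which is a direct sum of Lie algebras $H=S\oplus P$, where $S$ is a torus and $P$ is the set of all $p$-nilpotent elements of $H$; moreover, for the same $S$, there is a restricted ideal $N$ of $L$ such that $L=S\dotplus N$ (direct sum of vector spaces), $[[N,N],N]=0$ and $N^{[p]}\subseteq Z(H)$, where $Z(H)$ is the centre of $H$. -/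

import Mathlib

/-- `jacobsonCoeff x y n k` is the coefficient of `X ^ k` in `(ad (x ⊗ X + y ⊗ 1)) ^ n (x ⊗ 1)`,
computed in `L ⊗ F[X]` (see `ad_pow_eq_sum_jacobsonCoeff`). -/
def jacobsonCoeff {L : Type*} [LieRing L] (x y : L) : ℕ → ℕ → L
  | 0, 0 => x
  | 0, _ + 1 => 0
  | n + 1, 0 => ⁅y, jacobsonCoeff x y n 0⁆
  | n + 1, k + 1 => ⁅x, jacobsonCoeff x y n k⁆ + ⁅y, jacobsonCoeff x y n (k + 1)⁆

theorem jacobsonCoeff_eq_zero {L : Type*} [LieRing L] (x y : L) :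
    ∀ n k : ℕ, n < k → jacobsonCoeff x y n k = 0
  | 0, 0, h => absurd h (lt_irrefl 0)
  | 0, _ + 1, _ => rfl
  | _ + 1, 0, h => absurd h (Nat.not_lt_zero _)
  | n + 1, k + 1, h => by
      rw [jacobsonCoeff, jacobsonCoeff_eq_zero x y n k (by omega),
        jacobsonCoeff_eq_zero x y n (k + 1) (by omega), lie_zero, lie_zero, add_zero]

open scoped TensorProduct in
theorem ad_pow_eq_sum_jacobsonCoeff (F : Type*) {L : Type*} [Field F] [LieRing L] [LieAlgebra F L]
    (x y : L) (n : ℕ) :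
    ((LieAlgebra.ad (Polynomial F) (Polynomial F ⊗[F] L)
        ((Polynomial.X : Polynomial F) ⊗ₜ[F] x + (1 : Polynomial F) ⊗ₜ[F] y)) ^ n)
        ((1 : Polynomial F) ⊗ₜ[F] x) =
      ∑ k ∈ Finset.range (n + 1),
        ((Polynomial.X : Polynomial F) ^ k) ⊗ₜ[F] jacobsonCoeff x y n k := by
  induction n with
  | zero => simp [jacobsonCoeff]
  | succ n ih =>
    rw [pow_succ', Module.End.mul_apply, ih, LieAlgebra.ad_apply, add_lie, lie_sum, lie_sum,
      Finset.sum_range_succ' _ (n + 1)]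
    simp only [LieAlgebra.ExtendScalars.bracket_tmul, jacobsonCoeff, TensorProduct.tmul_add,
      Finset.sum_add_distrib, one_mul, ← pow_succ', pow_zero]
    rw [add_assoc]
    congr 1
    rw [Finset.sum_range_succ' _ n, Finset.sum_range_succ _ n,
      jacobsonCoeff_eq_zero x y n (n + 1) (Nat.lt_succ_self n)]
    simp

/-- The terms `s_i(x, y)`, `1 ≤ i ≤ p - 1`, of Jacobson's formula: `i • s_i(x, y)` is the
coefficient of `X ^ (i - 1)` in `(ad (x ⊗ X + y ⊗ 1)) ^ (p - 1) (x ⊗ 1)`. -/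
noncomputable def jacobsonTerm (p : ℕ) (F : Type*) {L : Type*} [Field F] [LieRing L]
    [LieAlgebra F L] (i : ℕ) (x y : L) : L :=
  (i : F)⁻¹ • jacobsonCoeff x y (p - 1) (i - 1)

/-- A `p`-mapping `x ↦ x^[p]` on a Lie algebra `L` over a field `F` of characteristic `p > 0`.
A restricted Lie algebra is a Lie algebra together with a `p`-mapping. -/
structure PMapping (p : ℕ) (F L : Type*) [Fact p.Prime] [Field F] [CharP F p] [LieRing L]
    [LieAlgebra F L] where
  toFun : L → L
  ad_toFun : ∀ x : L, LieAlgebra.ad F L (toFun x) = (LieAlgebra.ad F L x) ^ p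
  toFun_smul : ∀ (a : F) (x : L), toFun (a • x) = a ^ p • toFun x
  toFun_add : ∀ x y : L,
    toFun (x + y) = toFun x + toFun y + ∑ i ∈ Finset.Icc 1 (p - 1), jacobsonTerm p F i x y

namespace PMapping

variable {p : ℕ} {F L : Type*} [Fact p.Prime] [Field F] [CharP F p] [LieRing L] [LieAlgebra F L]

/-- The subalgebra `K` is a restricted subalgebra: it is closed under the `p`-mapping. -/
def IsRestricted (R : PMapping p F L) (K : LieSubalgebra F L) : Prop :=
  ∀ x ∈ K, R.toFun x ∈ K

/-- The restricted subalgebra `⟨A⟩_p` generated by a subset `A` of `L`. -/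
def closure (R : PMapping p F L) (A : Set L) : LieSubalgebra F L :=
  sInf {K : LieSubalgebra F L | R.IsRestricted K ∧ A ⊆ K}

/-- `S` is a restricted quasi-ideal: a restricted subalgebra with `[S, H] ⊆ S + H` for every
restricted subalgebra `H`. -/
def IsRestrictedQuasiIdeal (R : PMapping p F L) (S : LieSubalgebra F L) : Prop :=
  R.IsRestricted S ∧ ∀ H : LieSubalgebra F L, R.IsRestricted H →
    ∀ s ∈ S, ∀ h ∈ H, ⁅s, h⁆ ∈ S.toSubmodule ⊔ H.toSubmodule

/-- `x` is semisimple: `x ∈ ⟨x^[p]⟩_p`. -/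
def IsSemisimpleElt (R : PMapping p F L) (x : L) : Prop :=
  x ∈ R.closure {R.toFun x}

/-- `x` is `p`-nilpotent: `x^[p]^n = 0` for some `n > 0`. -/
def IsPNilpotent (R : PMapping p F L) (x : L) : Prop :=
  ∃ n : ℕ, 0 < n ∧ R.toFun^[n] x = 0

/-- `S` is a torus: an abelian restricted subalgebra consisting of semisimple elements. -/
def IsTorus (R : PMapping p F L) (S : LieSubalgebra F L) : Prop :=
  R.IsRestricted S ∧ IsLieAbelian S ∧ ∀ x ∈ S, R.IsSemisimpleElt x

/-- The restricted subalgebra `A^[p]` generated by all `x^[p]` with `x ∈ A`. -/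
def pPower (R : PMapping p F L) (A : Set L) : LieSubalgebra F L :=
  R.closure (R.toFun '' A)

end PMapping

/-! ### Fitting decomposition of a `p`-semilinear map -/

section SemilinearDecomposition

open Polynomial

variable {p : ℕ} {F V : Type*} [Field F] [AddCommGroup V] [Module F V] {φ : V →+ V}

/-! Write ⟨x⟩ for the span of the iterated `p`-th powers of `x`. The quasi-ideal hypothesis enters
only as [x, y] ∈ ⟨x⟩ + ⟨y⟩ (`exists_lie_eq_add`). The `p`-mapping is semilinear on the abelian
algebra ⟨x⟩, so the Fitting decomposition gives x = s + n, with `s` a combination of toral elements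
(t^[p] = t) and `n` `p`-nilpotent (`exists_jordan`).

Nilpotent side: for `p`-nilpotent `x`, `y`, nilpotency of `ad x` and `ad y` removes `x` and `y`
themselves from the expression of [x, y], leaving `p`-th powers, which commute with all
`p`-nilpotent elements (`lie_of_iterate_eq_zero`). Hence the `p`-nilpotent elements form a
subalgebra of class at most 2.

Toral side: `ad t` is diagonalizable for toral `t`, and comparing eigencomponents of [t, x + y]
shows that at most one nonzero eigenvalue occurs (`eq_zero_or_eq_zero_of_eigen`). Combining two
toral elements then yields a `t` with eigenvalues in {0, 1} such that toral elements of its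
centralizer are central there (`exists_toral`).

Take H to be that centralizer, S the span of its toral elements and N the set of all `p`-nilpotent
elements. The eigenvalue-1 space lies in N (`exists_iterate_eq_zero_of_lie_eq_self`), so L = S + N.
-/

theorem iterate_smul_of_smul (hφ : ∀ (a : F) (v : V), φ (a • v) = a ^ p • φ v) (k : ℕ) (a : F)
    (v : V) : φ^[k] (a • v) = a ^ p ^ k • φ^[k] v := by
  induction k with
  | zero => simp
  | succ k ih =>
    rw [Function.iterate_succ_apply', Function.iterate_succ_apply', ih, hφ, ← pow_mul, ← pow_succ]

theorem iterate_eq_zero_of_le {φ : V → V} (h0 : φ 0 = 0) {k m : ℕ} (h : k ≤ m) {v : V}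
    (hv : φ^[k] v = 0) : φ^[m] v = 0 := by
  obtain ⟨d, rfl⟩ := Nat.exists_eq_add_of_le' h
  rw [Function.iterate_add_apply, hv, Function.iterate_fixed h0]

/-- The vectors killed by some iterate of a `p`-semilinear map. -/
def nilSubmodule (hφ : ∀ (a : F) (v : V), φ (a • v) = a ^ p • φ v) : Submodule F V where
  carrier := {v | ∃ k : ℕ, φ^[k] v = 0}
  zero_mem' := ⟨0, rfl⟩
  add_mem' := by
    rintro v w ⟨k, hk⟩ ⟨m, hm⟩
    refine ⟨max k m, ?_⟩
    rw [iterate_map_add, iterate_eq_zero_of_le (map_zero φ) (le_max_left k m) hk,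
      iterate_eq_zero_of_le (map_zero φ) (le_max_right k m) hm, add_zero]
  smul_mem' := by
    rintro a v ⟨k, hk⟩
    exact ⟨k, by rw [iterate_smul_of_smul hφ, hk, smul_zero]⟩

theorem map_mem_span_fixed (hφ : ∀ (a : F) (v : V), φ (a • v) = a ^ p • φ v) {v : V}
    (hv : v ∈ Submodule.span F {t | φ t = t}) : φ v ∈ Submodule.span F {t | φ t = t} := by
  induction hv using Submodule.span_induction with
  | mem t ht => rw [ht]; exact Submodule.subset_span ht
  | zero => simp
  | add v w _ _ hv hw => rw [map_add]; exact add_mem hv hw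
  | smul a v _ hv => rw [hφ]; exact Submodule.smul_mem _ _ hv

/-- In a basis of fixed vectors the map raises each coordinate to the `p`-th power, hence is
injective. -/
theorem eq_zero_of_mem_span_fixed [Fact p.Prime]
    (hφ : ∀ (a : F) (v : V), φ (a • v) = a ^ p • φ v) {v : V}
    (hv : v ∈ Submodule.span F {t | φ t = t}) (h0 : φ v = 0) : v = 0 := by
  obtain ⟨b, hb, hspan, hli⟩ := exists_linearIndependent F {t | φ t = t}
  rw [← hspan, ← Set.image_id b, Finsupp.mem_span_image_iff_linearCombination] at hv
  obtain ⟨l, hl, rfl⟩ := hv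
  have hp : p ≠ 0 := (Fact.out : p.Prime).ne_zero
  have key : Finsupp.linearCombination F id (l.mapRange (· ^ p) (zero_pow hp)) = (0 : V) := by
    rw [← h0, Finsupp.linearCombination_apply, Finsupp.linearCombination_apply,
      Finsupp.sum_mapRange_index (by simp), Finsupp.sum, Finsupp.sum, map_sum]
    refine Finset.sum_congr rfl fun t ht => ?_
    rw [hφ, id, hb (hl ht)]
  have hz := linearIndepOn_iff.mp (show LinearIndepOn F id b from hli) _ ?_ key
  · have : l = 0 := by
      ext t
      have := DFunLike.congr_fun hz t
      simpa [hp] using this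
    simp [this]
  · rw [Finsupp.mem_supported]
    exact (Finset.coe_subset.mpr Finsupp.support_mapRange).trans hl

theorem eq_zero_of_iterate_eq_zero [Fact p.Prime]
    (hφ : ∀ (a : F) (v : V), φ (a • v) = a ^ p • φ v) {v : V}
    (hv : v ∈ Submodule.span F {t | φ t = t}) {k : ℕ} (h0 : φ^[k] v = 0) : v = 0 := by
  induction k generalizing v with
  | zero => exact h0
  | succ k ih =>
    exact eq_zero_of_mem_span_fixed hφ hv (ih (map_mem_span_fixed hφ hv) h0)

theorem exists_map_eq_of_mem_span_fixed [IsAlgClosed F] [Fact p.Prime]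
    (hφ : ∀ (a : F) (v : V), φ (a • v) = a ^ p • φ v) {v : V}
    (hv : v ∈ Submodule.span F {t | φ t = t}) (a : F) :
    ∃ z ∈ Submodule.span F {t | φ t = t}, φ z = a • v := by
  induction hv using Submodule.span_induction generalizing a with
  | mem t ht =>
    obtain ⟨b, hb⟩ := IsAlgClosed.exists_pow_nat_eq a (Fact.out : p.Prime).pos
    exact ⟨b • t, Submodule.smul_mem _ _ (Submodule.subset_span ht), by rw [hφ, hb, ht]⟩
  | zero => exact ⟨0, zero_mem _, by simp⟩
  | add v w _ _ hv hw =>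
    obtain ⟨z, hz, h1⟩ := hv a
    obtain ⟨z', hz', h2⟩ := hw a
    exact ⟨z + z', add_mem hz hz', by rw [map_add, h1, h2, smul_add]⟩
  | smul c v _ hv =>
    obtain ⟨z, hz, h1⟩ := hv (a * c)
    exact ⟨z, hz, by rw [h1, mul_smul]⟩

theorem exists_map_sub_eq_of_mem_span_fixed [IsAlgClosed F] [Fact p.Prime]
    (hφ : ∀ (a : F) (v : V), φ (a • v) = a ^ p • φ v) {v : V}
    (hv : v ∈ Submodule.span F {t | φ t = t}) (a : F) :
    ∃ z ∈ Submodule.span F {t | φ t = t}, φ z - z = a • v := by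
  induction hv using Submodule.span_induction generalizing a with
  | mem t ht =>
    have hp : 1 < p := (Fact.out : p.Prime).one_lt
    have hdeg : (X ^ p - (X + C a) : F[X]).degree = p := by
      rw [degree_sub_eq_left_of_degree_lt] <;> rw [degree_X_pow]
      rw [degree_X_add_C]
      exact_mod_cast hp
    obtain ⟨b, hb⟩ := IsAlgClosed.exists_root (X ^ p - (X + C a) : F[X])
      (by rw [hdeg]; exact_mod_cast (by omega : p ≠ 0))
    have hb' : b ^ p - b = a := by
      simp only [IsRoot, eval_sub, eval_pow, eval_X, eval_add, eval_C] at hb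
      linear_combination hb
    exact ⟨b • t, Submodule.smul_mem _ _ (Submodule.subset_span ht), by
      rw [hφ, ht, ← sub_smul, hb']⟩
  | zero => exact ⟨0, zero_mem _, by simp⟩
  | add v w _ _ hv hw =>
    obtain ⟨z, hz, h1⟩ := hv a
    obtain ⟨z', hz', h2⟩ := hw a
    exact ⟨z + z', add_mem hz hz', by rw [map_add, smul_add, ← h1, ← h2]; abel⟩
  | smul c v _ hv =>
    obtain ⟨z, hz, h1⟩ := hv (a * c)
    exact ⟨z, hz, by rw [h1, mul_smul]⟩

theorem exists_map_sub_eq_of_iterate_eq_zero {k : ℕ} {v : V} (hv : φ^[k] v = 0) :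
    ∃ w, (∃ m : ℕ, φ^[m] w = 0) ∧ φ w - w = v := by
  induction k generalizing v with
  | zero => exact ⟨0, ⟨0, rfl⟩, by simpa using hv.symm⟩
  | succ k ih =>
    obtain ⟨w, ⟨m, hm⟩, hw⟩ := ih (v := φ v) hv
    -- The recursion unrolls to the finite geometric series -(v + φ v + φ² v + ⋯).
    refine ⟨w - v, ⟨max m (k + 1), ?_⟩, by rw [map_sub, ← hw]; abel⟩
    rw [iterate_map_sub, iterate_eq_zero_of_le (map_zero φ) (le_max_left m (k + 1)) hm,
      iterate_eq_zero_of_le (map_zero φ) (le_max_right m (k + 1)) hv, sub_zero]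

/-- `φ` is surjective on the span of fixed vectors and `φ - 1` on both summands, so `x` can be
corrected to a nilpotent vector (`c = 0`) or, after rescaling, to a fixed one. -/
theorem mem_sup_of_map_sub_smul_mem [IsAlgClosed F] [Fact p.Prime]
    (hφ : ∀ (a : F) (v : V), φ (a • v) = a ^ p • φ v) {x : V} {c : F}
    (hx : φ x - c • x ∈ Submodule.span F {t | φ t = t} ⊔ nilSubmodule hφ) :
    x ∈ Submodule.span F {t | φ t = t} ⊔ nilSubmodule hφ := by
  by_cases hc : c = 0
  · obtain ⟨s, hs, n, ⟨k, hk⟩, h⟩ := Submodule.mem_sup.mp hx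
    obtain ⟨z, hz, hzs⟩ := exists_map_eq_of_mem_span_fixed hφ hs 1
    refine Submodule.mem_sup.mpr ⟨z, hz, x - z, ⟨k + 1, ?_⟩, add_sub_cancel _ _⟩
    rw [Function.iterate_succ_apply, map_sub, hzs, one_smul]
    rw [hc, zero_smul, sub_zero] at h
    rw [← h, add_sub_cancel_left, hk]
  · have hp : 1 < p := (Fact.out : p.Prime).one_lt
    -- This scaling turns `φ - c` into `φ - 1`: φ(bx) - bx = b^p (φ x - c x).
    obtain ⟨b, hb⟩ := IsAlgClosed.exists_pow_nat_eq (c⁻¹) (Nat.sub_pos_of_lt hp)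
    have hb0 : b ≠ 0 := by
      rintro rfl
      rw [zero_pow (Nat.sub_pos_of_lt hp).ne'] at hb
      exact inv_ne_zero hc hb.symm
    have hbp : b ^ p * c = b := by
      have : b ^ p = b ^ (p - 1) * b := by rw [← pow_succ, Nat.sub_add_cancel hp.le]
      rw [this, hb]; field_simp
    have hbx : φ (b • x) - b • x ∈ Submodule.span F {t | φ t = t} ⊔ nilSubmodule hφ := by
      have := Submodule.smul_mem _ (b ^ p) hx
      rwa [smul_sub, smul_smul, hbp, ← hφ] at this
    obtain ⟨s, hs, n, ⟨k, hk⟩, h⟩ := Submodule.mem_sup.mp hbx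
    obtain ⟨z, hz, hzs⟩ := exists_map_sub_eq_of_mem_span_fixed hφ hs 1
    obtain ⟨w, hw, hwn⟩ := exists_map_sub_eq_of_iterate_eq_zero hk
    have hfix : φ (b • x - z - w) = b • x - z - w := by
      rw [one_smul] at hzs
      rw [map_sub, map_sub, ← sub_eq_zero]
      calc _ = (φ (b • x) - b • x) - (φ z - z) - (φ w - w) := by abel
        _ = 0 := by rw [hzs, hwn, ← h]; abel
    have hmem : b • x ∈ Submodule.span F {t | φ t = t} ⊔ nilSubmodule hφ := by
      have h1 : b • x = (b • x - z - w + z) + w := by abel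
      rw [h1]
      exact Submodule.add_mem_sup (add_mem (Submodule.subset_span hfix) hz) hw
    have := Submodule.smul_mem _ b⁻¹ hmem
    rwa [smul_smul, inv_mul_cancel₀ hb0, one_smul] at this

theorem exists_sum_range_of_mem_span_image {f : ℕ → V} {m : ℕ} {w : V}
    (hw : w ∈ Submodule.span F (f '' (Finset.range m : Set ℕ))) :
    ∃ c : ℕ → F, ∑ i ∈ Finset.range m, c i • f i = w := by
  obtain ⟨c, rfl⟩ := (Submodule.mem_span_image_finset_iff_exists_fun F).mp hw
  refine ⟨fun i => if h : i ∈ Finset.range m then c ⟨i, h⟩ else 0, ?_⟩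
  rw [← Finset.sum_attach, Finset.univ_eq_attach]
  exact Finset.sum_congr rfl fun i _ => congrArg (· • f i) (dif_pos i.2)

/-- A skew polynomial in `φ` is split by right division: a root `r` gives a right factor `φ - r`,
and the quotient is a relation of lower degree for φ x - r x. -/
theorem mem_sup_of_iterate_mem [IsAlgClosed F] [Fact p.Prime]
    (hφ : ∀ (a : F) (v : V), φ (a • v) = a ^ p • φ v) (m : ℕ) {x : V}
    (hx : φ^[m] x ∈ (Submodule.span F {t | φ t = t} ⊔ nilSubmodule hφ) ⊔
      Submodule.span F ((fun i => φ^[i] x) '' (Finset.range m : Set ℕ))) :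
    x ∈ Submodule.span F {t | φ t = t} ⊔ nilSubmodule hφ := by
  induction m generalizing x with
  | zero => simpa using hx
  | succ m ih =>
    obtain ⟨d, hd, w, hw, hdw⟩ := Submodule.mem_sup.mp hx
    obtain ⟨c, rfl⟩ := exists_sum_range_of_mem_span_image hw
    -- If φ x = r x, then φ^j x = r^(1 + p + ⋯ + p^(j-1)) x; these exponents define the polynomial
    -- whose root is needed.
    set e : ℕ → ℕ := fun j => ∑ k ∈ Finset.range j, p ^ k with he
    have hp : 0 < p := (Fact.out : p.Prime).pos
    have he_succ : ∀ j, e (j + 1) = e j + p ^ j := fun j => Finset.sum_range_succ _ _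
    have he_mono : StrictMono e := strictMono_nat_of_lt_succ fun j => by
      rw [he_succ]; exact Nat.lt_add_of_pos_right (pow_pos hp j)
    have hdeg : (X ^ e (m + 1) - ∑ i ∈ Finset.range (m + 1), C (c i) * X ^ e i : F[X]).degree
        = e (m + 1) := by
      rw [degree_sub_eq_left_of_degree_lt] <;> rw [degree_X_pow]
      refine (Finset.sup_lt_iff (WithBot.bot_lt_coe _)).mpr ?_ |>.trans_le' (degree_sum_le _ _)
      intro i hi
      exact (degree_C_mul_X_pow_le _ _).trans_lt
        (by exact_mod_cast he_mono (Finset.mem_range.mp hi))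
    obtain ⟨r, hr⟩ := IsAlgClosed.exists_root _ (by
      rw [hdeg]
      exact_mod_cast (Nat.zero_le (e 0)).trans_lt (he_mono m.succ_pos) |>.ne' :
        (X ^ e (m + 1) - ∑ i ∈ Finset.range (m + 1), C (c i) * X ^ e i : F[X]).degree ≠ 0)
    have hr' : r ^ e (m + 1) = ∑ i ∈ Finset.range (m + 1), c i * r ^ e i := by
      simpa [IsRoot, eval_finsetSum, sub_eq_zero] using hr
    refine mem_sup_of_map_sub_smul_mem hφ (c := r) (ih ?_)
    set y := φ x - r • x with hy
    set W : ℕ → Submodule F V := fun j =>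
      Submodule.span F ((fun i => φ^[i] y) '' (Finset.range j : Set ℕ)) with hW
    have hWmono : Monotone W := fun i j hij => Submodule.span_mono (Set.image_mono
      (by simpa using Finset.range_mono hij))
    have step : ∀ j, φ^[j + 1] x - r ^ e (j + 1) • x - φ^[j] y =
        r ^ p ^ j • (φ^[j] x - r ^ e j • x) := fun j => by
      rw [hy, iterate_map_sub, iterate_smul_of_smul hφ, he_succ, pow_add,
        Function.iterate_succ_apply, smul_sub, smul_smul, mul_comm (r ^ e j)]
      abel
    have hmem : ∀ j, φ^[j] x - r ^ e j • x ∈ W j := fun j => by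
      induction j with
      | zero => simp [he]
      | succ j ihj =>
        have h1 := Submodule.smul_mem _ (r ^ p ^ j) (hWmono j.le_succ ihj)
        rw [← step] at h1
        have h2 : φ^[j] y ∈ W (j + 1) := Submodule.subset_span ⟨j, by simp, rfl⟩
        simpa using add_mem h1 h2
    have hsum : ∑ i ∈ Finset.range (m + 1), c i • (φ^[i] x - r ^ e i • x) ∈ W m :=
      sum_mem fun i hi => Submodule.smul_mem _ _
        (hWmono (Nat.lt_succ_iff.mp (Finset.mem_range.mp hi)) (hmem i))
    have h3 : φ^[m] y = d + (∑ i ∈ Finset.range (m + 1), c i • (φ^[i] x - r ^ e i • x) -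
        r ^ p ^ m • (φ^[m] x - r ^ e m • x)) := by
      have h4 := step m
      rw [← h4, ← hdw, hr']
      simp only [smul_sub, Finset.sum_sub_distrib, Finset.sum_smul, smul_smul]
      abel
    rw [h3]
    exact Submodule.add_mem_sup hd (sub_mem hsum (Submodule.smul_mem _ _ (hmem m)))

/-- The Fitting decomposition of a `p`-semilinear endomorphism over an algebraically closed
field, the bijective part being spanned by fixed vectors. -/
theorem span_fixed_sup_nilSubmodule_eq_top [IsAlgClosed F] [Fact p.Prime] [FiniteDimensional F V]
    (hφ : ∀ (a : F) (v : V), φ (a • v) = a ^ p • φ v) :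
    Submodule.span F {t | φ t = t} ⊔ nilSubmodule hφ = ⊤ := by
  rw [eq_top_iff]
  rintro x -
  obtain ⟨n, hn⟩ := monotone_stabilizes_iff_noetherian.mpr
    (inferInstance : IsNoetherian F V) ⟨fun m : ℕ =>
      Submodule.span F ((fun i => φ^[i] x) '' (Finset.range m : Set ℕ)),
      fun i j hij => Submodule.span_mono (Set.image_mono (by simpa using Finset.range_mono hij))⟩
  refine mem_sup_of_iterate_mem hφ n (Submodule.mem_sup_right ?_)
  have h := hn (n + 1) n.le_succ
  change Submodule.span F _ = Submodule.span F _ at h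
  rw [h]
  exact Submodule.subset_span ⟨n, by simp, rfl⟩

end SemilinearDecomposition

/-! ### Vanishing of the Jacobson terms -/

/-- The first bracket produces [y, x], which the second kills. For p ≥ 3 the exponent p - 1 is at
least 2, so the `p`-mapping is additive on such pairs. -/
theorem jacobsonCoeff_eq_zero_of_lie_eq_zero {L : Type*} [LieRing L] {x y : L}
    (hx : ⁅x, ⁅x, y⁆⁆ = 0) (hy : ⁅y, ⁅x, y⁆⁆ = 0) {n : ℕ} (hn : 2 ≤ n) (k : ℕ) :
    jacobsonCoeff x y n k = 0 := by
  have hx' : ⁅x, ⁅y, x⁆⁆ = 0 := by rw [← lie_skew y x, lie_neg, hx, neg_zero]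
  have hy' : ⁅y, ⁅y, x⁆⁆ = 0 := by rw [← lie_skew y x, lie_neg, hy, neg_zero]
  induction n, hn using Nat.le_induction generalizing k with
  | base =>
    have h1 : ∀ k, jacobsonCoeff x y 1 (k + 1) = 0 := by
      rintro (_ | k)
      · simp [jacobsonCoeff]
      · exact jacobsonCoeff_eq_zero x y 1 _ (by omega)
    rcases k with _ | _ | k
    · simp [jacobsonCoeff, hy']
    · rw [jacobsonCoeff, h1]; simp [jacobsonCoeff, hx']
    · rw [jacobsonCoeff, h1, h1]; simp
  | succ n hn ih =>
    rcases k with _ | k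
    · rw [jacobsonCoeff, ih, lie_zero]
    · rw [jacobsonCoeff, ih, ih, lie_zero, lie_zero, add_zero]

/-! ### Spans of commuting elements -/

section SpanOfCommuting

variable {F L : Type*} [Field F] [LieRing L] [LieAlgebra F L]

theorem lie_eq_zero_of_mem_span {A : Set L} {x y : L} (hA : ∀ a ∈ A, ⁅a, y⁆ = 0)
    (hx : x ∈ Submodule.span F A) : ⁅x, y⁆ = 0 := by
  induction hx using Submodule.span_induction with
  | mem a ha => exact hA a ha
  | zero => exact zero_lie y
  | add a b _ _ ha hb => rw [add_lie, ha, hb, add_zero]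
  | smul c a _ ha => rw [smul_lie, ha, smul_zero]

theorem lie_eq_zero_comm {x y : L} (h : ⁅x, y⁆ = 0) : ⁅y, x⁆ = 0 := by
  rw [← lie_skew, h, neg_zero]

theorem lie_eq_zero_of_mem_span_of_mem_span {A : Set L} (hA : ∀ a ∈ A, ∀ b ∈ A, ⁅a, b⁆ = 0)
    {x y : L} (hx : x ∈ Submodule.span F A) (hy : y ∈ Submodule.span F A) : ⁅x, y⁆ = 0 :=
  lie_eq_zero_of_mem_span (fun a ha => lie_eq_zero_comm <|
    lie_eq_zero_of_mem_span (fun b hb => hA b hb a ha) hy) hx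

/-- The abelian subalgebra spanned by a set of commuting elements. -/
def LieSubalgebra.spanOfCommute (F : Type*) {L : Type*} [Field F] [LieRing L] [LieAlgebra F L]
    (A : Set L) (hA : ∀ a ∈ A, ∀ b ∈ A, ⁅a, b⁆ = 0) : LieSubalgebra F L :=
  { Submodule.span F A with
    lie_mem' := fun {x y} hx hy => by
      rw [lie_eq_zero_of_mem_span_of_mem_span hA hx hy]
      exact zero_mem (Submodule.span F A) }

end SpanOfCommuting

/-! ### Cyclic restricted subalgebras and the Jordan decomposition -/

namespace PMapping

variable {p : ℕ} {F L : Type*} [Fact p.Prime] [Field F] [CharP F p] [LieRing L] [LieAlgebra F L]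
  (R : PMapping p F L)

theorem toFun_zero : R.toFun 0 = 0 := by
  have h := R.toFun_smul 0 0
  rwa [zero_pow (Fact.out : p.Prime).ne_zero, zero_smul, zero_smul] at h

theorem toFun_add_of_lie_lie_eq_zero (hp : p ≠ 2) {x y : L} (hx : ⁅x, ⁅x, y⁆⁆ = 0)
    (hy : ⁅y, ⁅x, y⁆⁆ = 0) : R.toFun (x + y) = R.toFun x + R.toFun y := by
  have := (Fact.out : p.Prime).two_le
  rw [R.toFun_add, Finset.sum_eq_zero, add_zero]
  intro i _
  rw [jacobsonTerm, jacobsonCoeff_eq_zero_of_lie_eq_zero hx hy (by omega), smul_zero]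

theorem toFun_add_of_commute (hp : p ≠ 2) {x y : L} (h : ⁅x, y⁆ = 0) :
    R.toFun (x + y) = R.toFun x + R.toFun y :=
  R.toFun_add_of_lie_lie_eq_zero hp (by rw [h, lie_zero]) (by rw [h, lie_zero])

theorem toFun_lie (x y : L) : ⁅R.toFun x, y⁆ = (LieAlgebra.ad F L x ^ p) y := by
  rw [← R.ad_toFun, LieAlgebra.ad_apply]

theorem ad_iterate (k : ℕ) (x : L) :
    LieAlgebra.ad F L (R.toFun^[k] x) = LieAlgebra.ad F L x ^ p ^ k := by
  induction k with
  | zero => simp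
  | succ k ih => rw [Function.iterate_succ_apply', R.ad_toFun, ih, ← pow_mul, pow_succ]

theorem toFun_lie_eq_zero_of_ad_pow {x y : L} {k : ℕ} (hk : k ≤ p)
    (h : (LieAlgebra.ad F L x ^ k) y = 0) : ⁅R.toFun x, y⁆ = 0 := by
  rw [toFun_lie, ← Nat.sub_add_cancel hk, pow_add, Module.End.mul_apply, h, map_zero]

theorem toFun_lie_eq_zero {x y : L} (h : ⁅x, y⁆ = 0) : ⁅R.toFun x, y⁆ = 0 :=
  R.toFun_lie_eq_zero_of_ad_pow (k := 1) (Fact.out : p.Prime).one_le (by simpa using h)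

theorem iterate_lie_eq_zero {x y : L} (h : ⁅x, y⁆ = 0) (k : ℕ) : ⁅R.toFun^[k] x, y⁆ = 0 := by
  induction k with
  | zero => exact h
  | succ k ih => rw [Function.iterate_succ_apply']; exact R.toFun_lie_eq_zero ih

theorem iterate_lie_iterate (x : L) (i j : ℕ) : ⁅R.toFun^[i] x, R.toFun^[j] x⁆ = 0 :=
  R.iterate_lie_eq_zero (lie_eq_zero_comm (R.iterate_lie_eq_zero (lie_self x) j)) i

/-- A span of commuting elements is restricted as soon as it contains their `p`-th powers. -/
theorem toFun_mem_span (hp : p ≠ 2) {A : Set L} (hA : ∀ a ∈ A, ∀ b ∈ A, ⁅a, b⁆ = 0)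
    (hR : ∀ a ∈ A, R.toFun a ∈ Submodule.span F A) {x : L} (hx : x ∈ Submodule.span F A) :
    R.toFun x ∈ Submodule.span F A := by
  induction hx using Submodule.span_induction with
  | mem a ha => exact hR a ha
  | zero => rw [R.toFun_zero]; exact zero_mem _
  | add a b ha hb ha' hb' =>
    rw [R.toFun_add_of_commute hp (lie_eq_zero_of_mem_span_of_mem_span hA ha hb)]
    exact add_mem ha' hb'
  | smul c a _ ha => rw [R.toFun_smul]; exact Submodule.smul_mem _ _ ha

/-- The subalgebra spanned by the iterated `p`-th powers of `x`. -/
def cyclic (x : L) : LieSubalgebra F L :=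
  LieSubalgebra.spanOfCommute F (Set.range fun i => R.toFun^[i] x) (by
    rintro _ ⟨i, rfl⟩ _ ⟨j, rfl⟩
    exact R.iterate_lie_iterate x i j)

theorem mem_cyclic {x w : L} :
    w ∈ R.cyclic x ↔ w ∈ Submodule.span F (Set.range fun i => R.toFun^[i] x) := Iff.rfl

theorem iterate_mem_cyclic (x : L) (i : ℕ) : R.toFun^[i] x ∈ R.cyclic x :=
  R.mem_cyclic.mpr (Submodule.subset_span ⟨i, rfl⟩)

theorem self_mem_cyclic (x : L) : x ∈ R.cyclic x := R.iterate_mem_cyclic x 0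

theorem cyclic_lie_cyclic {x v w : L} (hv : v ∈ R.cyclic x) (hw : w ∈ R.cyclic x) :
    ⁅v, w⁆ = 0 :=
  lie_eq_zero_of_mem_span_of_mem_span (by
    rintro _ ⟨i, rfl⟩ _ ⟨j, rfl⟩
    exact R.iterate_lie_iterate x i j) (R.mem_cyclic.mp hv) (R.mem_cyclic.mp hw)

theorem isRestricted_cyclic (hp : p ≠ 2) (x : L) : R.IsRestricted (R.cyclic x) := by
  intro w hw
  rw [mem_cyclic] at hw ⊢
  refine R.toFun_mem_span hp ?_ ?_ hw
  · rintro _ ⟨i, rfl⟩ _ ⟨j, rfl⟩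
    exact R.iterate_lie_iterate x i j
  · rintro _ ⟨i, rfl⟩
    exact Submodule.subset_span ⟨i + 1, Function.iterate_succ_apply' _ _ _⟩

theorem iterate_mem {K : LieSubalgebra F L} (hK : R.IsRestricted K) {x : L} (hx : x ∈ K) (i : ℕ) :
    R.toFun^[i] x ∈ K := by
  induction i with
  | zero => exact hx
  | succ i ih => rw [Function.iterate_succ_apply']; exact hK _ ih

theorem cyclic_le {K : LieSubalgebra F L} (hK : R.IsRestricted K) {x : L} (hx : x ∈ K) :
    R.cyclic x ≤ K := by
  intro w hw
  rw [mem_cyclic] at hw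
  refine Submodule.span_le (p := K.toSubmodule) |>.mpr ?_ hw
  rintro _ ⟨i, rfl⟩
  exact R.iterate_mem hK hx i

theorem cyclic_toFun_le (x : L) : R.cyclic (R.toFun x) ≤ R.cyclic x := by
  intro w hw
  rw [mem_cyclic] at hw ⊢
  refine Submodule.span_mono ?_ hw
  rintro _ ⟨i, rfl⟩
  exact ⟨i + 1, rfl⟩

theorem cyclic_lie_eq_zero {x y w : L} (h : ⁅x, y⁆ = 0) (hw : w ∈ R.cyclic x) : ⁅w, y⁆ = 0 :=
  lie_eq_zero_of_mem_span (by rintro _ ⟨i, rfl⟩; exact R.iterate_lie_eq_zero h i)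
    (R.mem_cyclic.mp hw)

theorem exists_of_mem_cyclic {x w : L} (hw : w ∈ R.cyclic x) :
    ∃ a : F, ∃ v ∈ R.cyclic (R.toFun x), w = a • x + v := by
  rw [mem_cyclic] at hw
  induction hw using Submodule.span_induction with
  | mem w hw =>
    obtain ⟨_ | i, rfl⟩ := hw
    · exact ⟨1, 0, zero_mem _, by simp⟩
    · exact ⟨0, _, R.iterate_mem_cyclic _ i, by simp⟩
  | zero => exact ⟨0, 0, zero_mem _, by simp⟩
  | add w w' _ _ hw hw' =>
    obtain ⟨a, v, hv, rfl⟩ := hw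
    obtain ⟨b, v', hv', rfl⟩ := hw'
    exact ⟨a + b, v + v', add_mem hv hv', by rw [add_smul]; abel⟩
  | smul c w _ hw =>
    obtain ⟨a, v, hv, rfl⟩ := hw
    exact ⟨c * a, c • v, (R.cyclic (R.toFun x)).smul_mem c hv, by rw [smul_add, mul_smul]⟩

/-- Used mainly for toral `w`: then w = w^[p] already lies in the algebra generated by x^[p]. -/
theorem toFun_mem_cyclic_toFun (hp : p ≠ 2) {x w : L} (hw : w ∈ R.cyclic x) :
    R.toFun w ∈ R.cyclic (R.toFun x) := by
  obtain ⟨a, v, hv, rfl⟩ := R.exists_of_mem_cyclic hw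
  have hc : ⁅a • x, v⁆ = 0 := R.cyclic_lie_cyclic
    ((R.cyclic x).smul_mem a (R.self_mem_cyclic x)) (R.cyclic_toFun_le x hv)
  rw [R.toFun_add_of_commute hp hc, R.toFun_smul]
  exact add_mem ((R.cyclic _).smul_mem _ (R.self_mem_cyclic _)) (R.isRestricted_cyclic hp _ _ hv)

theorem cyclic_le_of_toFun_eq {t w : L} (ht : R.toFun t = t) (hw : w ∈ R.cyclic t) :
    ∃ a : F, w = a • t := by
  rw [mem_cyclic, show (Set.range fun i => R.toFun^[i] t) = {t} from ?_,
    Submodule.mem_span_singleton] at hw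
  · obtain ⟨a, ha⟩ := hw
    exact ⟨a, ha.symm⟩
  · ext w
    simp [Function.iterate_fixed ht, eq_comm]

/-- The `p`-mapping of an abelian restricted subalgebra, as an additive map. -/
def restrictHom (hp : p ≠ 2) (K : LieSubalgebra F L) (hK : R.IsRestricted K)
    (hab : ∀ x ∈ K, ∀ y ∈ K, ⁅x, y⁆ = 0) : K →+ K where
  toFun x := ⟨R.toFun x, hK x x.2⟩
  map_zero' := Subtype.ext R.toFun_zero
  map_add' x y := Subtype.ext (R.toFun_add_of_commute hp (hab x x.2 y y.2))

theorem restrictHom_smul (hp : p ≠ 2) (K : LieSubalgebra F L) (hK : R.IsRestricted K)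
    (hab : ∀ x ∈ K, ∀ y ∈ K, ⁅x, y⁆ = 0) (a : F) (v : K) :
    R.restrictHom hp K hK hab (a • v) = a ^ p • R.restrictHom hp K hK hab v :=
  Subtype.ext (R.toFun_smul a v)

theorem coe_iterate_restrictHom (hp : p ≠ 2) (K : LieSubalgebra F L) (hK : R.IsRestricted K)
    (hab : ∀ x ∈ K, ∀ y ∈ K, ⁅x, y⁆ = 0) (k : ℕ) (v : K) :
    (((R.restrictHom hp K hK hab)^[k] v : K) : L) = R.toFun^[k] v := by
  induction k generalizing v with
  | zero => rfl
  | succ k ih => rw [Function.iterate_succ_apply, ih]; rfl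

/-- The Jordan decomposition of an element of a restricted Lie algebra. -/
theorem exists_jordan [IsAlgClosed F] [FiniteDimensional F L] (hp : p ≠ 2) (x : L) :
    ∃ s ∈ Submodule.span F {t | t ∈ R.cyclic x ∧ R.toFun t = t},
      ∃ n ∈ R.cyclic x, (∃ k, R.toFun^[k] n = 0) ∧ s + n = x := by
  set K := R.cyclic x
  have hab : ∀ v ∈ K, ∀ w ∈ K, ⁅v, w⁆ = 0 := fun v hv w hw => R.cyclic_lie_cyclic hv hw
  have hK := R.isRestricted_cyclic hp x
  have hx : (⟨x, R.self_mem_cyclic x⟩ : K) ∈ (⊤ : Submodule F K) := trivial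
  rw [← span_fixed_sup_nilSubmodule_eq_top (R.restrictHom_smul hp K hK hab)] at hx
  obtain ⟨s, hs, n, ⟨k, hk⟩, hsn⟩ := Submodule.mem_sup.mp hx
  refine ⟨s, ?_, n, n.2, ⟨k, ?_⟩, congrArg Subtype.val hsn⟩
  · have h := Submodule.mem_map_of_mem (f := K.toSubmodule.subtype) hs
    rw [Submodule.map_span] at h
    refine Submodule.span_mono ?_ h
    rintro _ ⟨t, ht, rfl⟩
    exact ⟨t.2, congrArg Subtype.val ht⟩
  · rw [← R.coe_iterate_restrictHom hp K hK hab, hk]; rfl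

theorem exists_iterate_eq_zero_of_mem_cyclic (hp : p ≠ 2) {x w : L} {k : ℕ}
    (hx : R.toFun^[k] x = 0) (hw : w ∈ R.cyclic x) : R.toFun^[k] w = 0 := by
  induction k generalizing x w with
  | zero =>
    obtain rfl : x = 0 := hx
    exact (R.cyclic_le_of_toFun_eq R.toFun_zero hw).elim fun a ha => by simpa using ha
  | succ k ih => exact ih hx (R.toFun_mem_cyclic_toFun hp hw)

end PMapping

/-! ### The `p`-nilpotent elements -/

/-- `A w` satisfies A(Aw) = b Aw; as `A` is nilpotent, either b = 0 or Aw = 0. -/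
theorem apply_apply_eq_zero_of_pow_apply_eq_zero {F V : Type*} [Field F] [AddCommGroup V]
    [Module F V] {A : Module.End F V} {w z : V} {b : F} {m : ℕ} (hA : A ^ m = 0)
    (hw : A w = b • w + z) (hz : A z = 0) : A (A w) = 0 := by
  have h1 : A (A w) = b • A w := by rw [hw, map_add, map_smul, hz, add_zero, hw]
  have h2 : ∀ k : ℕ, (A ^ k) (A w) = b ^ k • A w := fun k => by
    induction k with
    | zero => simp
    | succ k ih => rw [pow_succ', Module.End.mul_apply, ih, map_smul, h1, smul_smul, pow_succ]
  rcases eq_or_ne b 0 with rfl | hb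
  · rw [h1, zero_smul]
  · have h3 := h2 m
    rw [hA, LinearMap.zero_apply] at h3
    rw [(smul_eq_zero.mp h3.symm).resolve_left (pow_ne_zero m hb), map_zero]

namespace PMapping

variable {p : ℕ} {F L : Type*} [Fact p.Prime] [Field F] [CharP F p] [LieRing L] [LieAlgebra F L]
  (R : PMapping p F L)

theorem exists_lie_eq_add (hp : p ≠ 2)
    (hL : ∀ K : LieSubalgebra F L, R.IsRestricted K → R.IsRestrictedQuasiIdeal K) (x y : L) :
    ∃ u ∈ R.cyclic x, ∃ v ∈ R.cyclic y, ⁅x, y⁆ = u + v := by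
  obtain ⟨u, hu, v, hv, h⟩ := Submodule.mem_sup.mp <|
    (hL _ (R.isRestricted_cyclic hp x)).2 _ (R.isRestricted_cyclic hp y) x (R.self_mem_cyclic x) y
      (R.self_mem_cyclic y)
  exact ⟨u, hu, v, hv, h.symm⟩

theorem ad_pow_eq_zero {x : L} {k : ℕ} (hx : R.toFun^[k] x = 0) :
    LieAlgebra.ad F L x ^ p ^ k = 0 := by
  rw [← R.ad_iterate, hx, map_zero]

/-- Bracketing the expansion with `x` gives (ad x)w = b w + c [x, y^[p]] for w = [x, y]. Nilpotency
of `ad x` then yields (ad x)³ y = 0, and p ≥ 3. -/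
theorem toFun_lie_eq_zero_of_lie_eq (hp : p ≠ 2) {x y g h' : L} {a b c : F} {m : ℕ}
    (hx : R.toFun^[m] x = 0) (hg : ⁅x, g⁆ = 0) (hh : ⁅x, h'⁆ = 0)
    (hxy : ⁅x, y⁆ = a • x + g + (b • y + (c • R.toFun y + h')))
    (hv : ⁅x, ⁅x, R.toFun y⁆⁆ = 0) : ⁅R.toFun x, y⁆ = 0 := by
  have h2 := (Fact.out : p.Prime).two_le
  refine R.toFun_lie_eq_zero_of_ad_pow (k := 3) (by omega) ?_
  have h3 := apply_apply_eq_zero_of_pow_apply_eq_zero (w := ⁅x, y⁆) (b := b)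
    (z := c • ⁅x, R.toFun y⁆) (R.ad_pow_eq_zero hx) ?_ ?_
  · simpa [pow_succ] using h3
  · rw [LieAlgebra.ad_apply]
    nth_rw 1 [hxy]
    simp [hg, hh]
  · simp [hv]

/-- Under the quasi-ideal condition, `p`-th powers of `p`-nilpotent elements commute with
`p`-nilpotent elements, and commutators of `p`-nilpotent elements are sums of `p`-th powers. -/
theorem lie_of_iterate_eq_zero (hp : p ≠ 2)
    (hQ : ∀ x y : L, ∃ u ∈ R.cyclic x, ∃ v ∈ R.cyclic y, ⁅x, y⁆ = u + v) {m n : ℕ} {x y : L}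
    (hx : R.toFun^[m] x = 0) (hy : R.toFun^[n] y = 0) :
    ⁅R.toFun x, y⁆ = 0 ∧ ⁅x, R.toFun y⁆ = 0 ∧
      ∃ u ∈ R.cyclic (R.toFun x), ∃ v ∈ R.cyclic (R.toFun y), ⁅x, y⁆ = u + v := by
  induction m generalizing x y n with
  | zero =>
    obtain rfl : x = 0 := hx
    exact ⟨by rw [R.toFun_zero, zero_lie], zero_lie _, 0, zero_mem _, 0, zero_mem _, by simp⟩
  | succ m ihm =>
    induction n generalizing y with
    | zero =>
      obtain rfl : y = 0 := hy
      exact ⟨lie_zero _, by rw [R.toFun_zero, lie_zero], 0, zero_mem _, 0, zero_mem _, by simp⟩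
    | succ n ihn =>
      -- The double induction replaces (x, y) by (x^[p], y) and by (x, y^[p]), each of smaller
      -- nilpotency order.
      obtain ⟨hx1, hx2, ux, hux, vx, hvx, hux'⟩ := ihm (x := R.toFun x) hx hy
      obtain ⟨hy1, hy2, uy, huy, vy, hvy, huy'⟩ := ihn (y := R.toFun y) hy
      obtain ⟨u, hu, v, hv, hxy⟩ := hQ x y
      obtain ⟨a, g, hg, rfl⟩ := R.exists_of_mem_cyclic hu
      obtain ⟨b, h, hh, rfl⟩ := R.exists_of_mem_cyclic hv
      obtain ⟨c, h', hh', rfl⟩ := R.exists_of_mem_cyclic hh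
      obtain ⟨d, g', hg', rfl⟩ := R.exists_of_mem_cyclic hg
      have hxc : ∀ w ∈ R.cyclic (R.toFun x), ⁅x, w⁆ = 0 := fun w hw =>
        R.cyclic_lie_cyclic (R.self_mem_cyclic x) (R.cyclic_toFun_le x hw)
      have hyc : ∀ w ∈ R.cyclic (R.toFun y), ⁅y, w⁆ = 0 := fun w hw =>
        R.cyclic_lie_cyclic (R.self_mem_cyclic y) (R.cyclic_toFun_le y hw)
      have hxy2 : ∀ w ∈ R.cyclic (R.toFun (R.toFun y)), ⁅x, w⁆ = 0 := fun w hw =>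
        lie_eq_zero_comm (R.cyclic_lie_eq_zero (lie_eq_zero_comm hy2) hw)
      have hyx2 : ∀ w ∈ R.cyclic (R.toFun (R.toFun x)), ⁅y, w⁆ = 0 := fun w hw =>
        lie_eq_zero_comm (R.cyclic_lie_eq_zero hx1 hw)
      have h1 : ⁅R.toFun x, y⁆ = 0 := by
        refine R.toFun_lie_eq_zero_of_lie_eq hp hx (hxc _ hg) (hxy2 _ hh') hxy ?_
        rw [huy', lie_add, hxc _ huy, hxy2 _ hvy, add_zero]
      have h2 : ⁅R.toFun y, x⁆ = 0 := by
        refine R.toFun_lie_eq_zero_of_lie_eq hp hy (a := -b) (g := -(c • R.toFun y + h')) (b := -a)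
          (c := -d) (h' := -g') ?_ ?_ ?_ ?_
        · rw [lie_neg, hyc _ hh, neg_zero]
        · rw [lie_neg, hyx2 _ hg', neg_zero]
        · rw [← lie_skew, hxy]
          simp only [neg_smul, neg_add_rev]
          abel
        · rw [← lie_skew y (R.toFun x), hux', lie_neg, lie_add, hyc _ hvx, hyx2 _ hux, add_zero, neg_zero]
      refine ⟨h1, lie_eq_zero_comm h2, ?_⟩
      by_cases hw : ⁅x, y⁆ = 0
      · exact ⟨0, zero_mem _, 0, zero_mem _, by rw [hw, add_zero]⟩
      -- A nonzero [x, y] cannot be an eigenvector of a nilpotent `ad z` with nonzero eigenvalue;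
      -- this kills the coefficients of `x` and `y`.
      have key : ∀ {z : L} {k : ℕ} {e : F}, R.toFun^[k] z = 0 → ⁅z, ⁅x, y⁆⁆ = e • ⁅x, y⁆ →
          e = 0 := fun {z k e} hz he => by
        have h3 := apply_apply_eq_zero_of_pow_apply_eq_zero (w := ⁅x, y⁆) (b := e) (z := 0)
          (R.ad_pow_eq_zero hz) (by simpa using he) (map_zero _)
        simpa [he, hw] using h3
      have hb : b = 0 := key hx <| by
        nth_rw 1 [hxy]
        simp [hxc _ (R.cyclic_toFun_le _ hg'), hxy2 _ hh',
          lie_eq_zero_comm h2, hxc _ (R.self_mem_cyclic _)]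
      have ha : -a = 0 := key hy <| by
        nth_rw 1 [hxy]
        simp [hyc _ (R.cyclic_toFun_le _ hh'), hyx2 _ hg',
          lie_eq_zero_comm h1, hyc _ (R.self_mem_cyclic _)]
        rw [← lie_skew, smul_neg]
      rw [neg_eq_zero] at ha
      exact ⟨_, hg, _, hh, by rw [hxy, ha, hb, zero_smul, zero_smul, zero_add, zero_add]⟩

theorem iterate_add_of_commute (hp : p ≠ 2) {x y : L} (h : ⁅x, y⁆ = 0) (k : ℕ) :
    R.toFun^[k] (x + y) = R.toFun^[k] x + R.toFun^[k] y := by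
  induction k generalizing x y with
  | zero => rfl
  | succ k ih =>
    rw [Function.iterate_succ_apply, R.toFun_add_of_commute hp h, ih]
    · rfl
    · exact R.toFun_lie_eq_zero (lie_eq_zero_comm (R.toFun_lie_eq_zero (lie_eq_zero_comm h)))

theorem iterate_smul (k : ℕ) (a : F) (x : L) :
    R.toFun^[k] (a • x) = a ^ p ^ k • R.toFun^[k] x := by
  induction k with
  | zero => simp
  | succ k ih =>
    rw [Function.iterate_succ_apply', Function.iterate_succ_apply', ih, R.toFun_smul, ← pow_mul,
      ← pow_succ]

theorem exists_iterate_add_eq_zero_of_commute (hp : p ≠ 2) {x y : L} (h : ⁅x, y⁆ = 0)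
    (hx : ∃ k, R.toFun^[k] x = 0) (hy : ∃ k, R.toFun^[k] y = 0) :
    ∃ k, R.toFun^[k] (x + y) = 0 := by
  obtain ⟨k, hk⟩ := hx
  obtain ⟨m, hm⟩ := hy
  refine ⟨max k m, ?_⟩
  rw [R.iterate_add_of_commute hp h, iterate_eq_zero_of_le R.toFun_zero (le_max_left k m) hk,
    iterate_eq_zero_of_le R.toFun_zero (le_max_right k m) hm, add_zero]

theorem exists_iterate_smul_eq_zero (a : F) {x : L} (hx : ∃ k, R.toFun^[k] x = 0) :
    ∃ k, R.toFun^[k] (a • x) = 0 := by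
  obtain ⟨k, hk⟩ := hx
  exact ⟨k, by rw [R.iterate_smul, hk, smul_zero]⟩

theorem exists_iterate_toFun_eq_zero {x : L} (hx : ∃ k, R.toFun^[k] x = 0) :
    ∃ k, R.toFun^[k] (R.toFun x) = 0 := by
  obtain ⟨k, hk⟩ := hx
  exact ⟨k, iterate_eq_zero_of_le (k := k) (m := k + 1) R.toFun_zero k.le_succ hk⟩

theorem lie_lie_eq_zero_of_nil (hp : p ≠ 2)
    (hQ : ∀ x y : L, ∃ u ∈ R.cyclic x, ∃ v ∈ R.cyclic y, ⁅x, y⁆ = u + v) {x y z : L}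
    (hx : ∃ k, R.toFun^[k] x = 0) (hy : ∃ k, R.toFun^[k] y = 0) (hz : ∃ k, R.toFun^[k] z = 0) :
    ⁅⁅x, y⁆, z⁆ = 0 := by
  obtain ⟨k, hk⟩ := hx
  obtain ⟨m, hm⟩ := hy
  obtain ⟨n, hn⟩ := hz
  obtain ⟨-, -, u, hu, v, hv, h⟩ := R.lie_of_iterate_eq_zero hp hQ hk hm
  rw [h, add_lie, R.cyclic_lie_eq_zero (R.lie_of_iterate_eq_zero hp hQ hk hn).1 hu,
    R.cyclic_lie_eq_zero (R.lie_of_iterate_eq_zero hp hQ hm hn).1 hv, add_zero]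

/-- Under the quasi-ideal condition, the `p`-nilpotent elements form a subalgebra. -/
def nilSubalgebra (hp : p ≠ 2)
    (hQ : ∀ x y : L, ∃ u ∈ R.cyclic x, ∃ v ∈ R.cyclic y, ⁅x, y⁆ = u + v) :
    LieSubalgebra F L where
  carrier := {x | ∃ k, R.toFun^[k] x = 0}
  zero_mem' := ⟨0, rfl⟩
  smul_mem' a _ hx := R.exists_iterate_smul_eq_zero a hx
  add_mem' := by
    intro x y hx hy
    -- Class 2 makes the `p`-mapping additive; the two `p`-th powers commute, so their sum is again
    -- `p`-nilpotent.
    have hadd : R.toFun (x + y) = R.toFun x + R.toFun y :=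
      R.toFun_add_of_lie_lie_eq_zero hp
        (lie_eq_zero_comm (R.lie_lie_eq_zero_of_nil hp hQ hx hy hx))
        (lie_eq_zero_comm (R.lie_lie_eq_zero_of_nil hp hQ hx hy hy))
    obtain ⟨m, hm⟩ := R.exists_iterate_toFun_eq_zero hy
    obtain ⟨n, hn⟩ := hx
    obtain ⟨k, hk⟩ := R.exists_iterate_add_eq_zero_of_commute hp
      (R.lie_of_iterate_eq_zero hp hQ hn hm).1 (R.exists_iterate_toFun_eq_zero ⟨n, hn⟩) ⟨m, hm⟩
    exact ⟨k + 1, by rw [Function.iterate_succ_apply, hadd, hk]⟩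
  lie_mem' := by
    rintro x y ⟨k, hk⟩ ⟨m, hm⟩
    obtain ⟨-, -, u, hu, v, hv, h⟩ := R.lie_of_iterate_eq_zero hp hQ hk hm
    have hu0 := R.exists_iterate_eq_zero_of_mem_cyclic hp hk (R.cyclic_toFun_le x hu)
    have hv0 := R.exists_iterate_eq_zero_of_mem_cyclic hp hm (R.cyclic_toFun_le y hv)
    obtain ⟨n, hn⟩ := R.exists_iterate_toFun_eq_zero ⟨m, hm⟩
    rw [h]
    refine R.exists_iterate_add_eq_zero_of_commute hp ?_ ⟨k, hu0⟩ ⟨m, hv0⟩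
    exact lie_eq_zero_comm (R.cyclic_lie_eq_zero (lie_eq_zero_comm (R.cyclic_lie_eq_zero
      (R.lie_of_iterate_eq_zero hp hQ hk hn).1 hu)) hv)

end PMapping

/-! ### Eigenvalues of toral elements -/

namespace PMapping

variable {p : ℕ} {F L : Type*} [Fact p.Prime] [Field F] [CharP F p] [LieRing L] [LieAlgebra F L]
  (R : PMapping p F L)

/-- (ad x)² t = 0 because [x, t] is a multiple of `x`. -/
theorem lie_toFun_eq_zero_of_lie_eq_smul {t x : L} {c : F} (hx : ⁅t, x⁆ = c • x) :
    ⁅t, R.toFun x⁆ = 0 := by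
  refine lie_eq_zero_comm (R.toFun_lie_eq_zero_of_ad_pow (k := 2) (Fact.out : p.Prime).two_le ?_)
  rw [pow_two, Module.End.mul_apply, LieAlgebra.ad_apply, LieAlgebra.ad_apply, ← lie_skew x t, hx,
    lie_neg, lie_smul, lie_self, smul_zero, neg_zero]

theorem lie_eq_zero_of_mem_cyclic_toFun {t x w : L} {c : F} (hx : ⁅t, x⁆ = c • x)
    (hw : w ∈ R.cyclic (R.toFun x)) : ⁅t, w⁆ = 0 :=
  lie_eq_zero_comm <| R.cyclic_lie_eq_zero
    (lie_eq_zero_comm (R.lie_toFun_eq_zero_of_lie_eq_smul hx)) hw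

theorem eq_zero_of_lie_add_eq_zero {t x y : L} {c d : F} (hc : c ≠ 0) (hcd : c ≠ d)
    (hx : ⁅t, x⁆ = c • x) (hy : ⁅t, y⁆ = d • y) (h : ⁅t, x + y⁆ = 0) : x = 0 := by
  rw [lie_add, hx, hy] at h
  have h' : ⁅t, c • x + d • y⁆ = 0 := by rw [h, lie_zero]
  rw [lie_add, lie_smul, lie_smul, hx, hy] at h'
  have h2 : (c * (c - d)) • x = 0 := by
    have h3 := congrArg (d • ·) h
    simp only [smul_add, smul_zero] at h3
    calc (c * (c - d)) • x = (c • c • x + d • d • y) - (d • c • x + d • d • y) := by module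
      _ = 0 := by rw [h', h3, sub_zero]
  exact (smul_eq_zero.mp h2).resolve_left (mul_ne_zero hc (sub_ne_zero.mpr hcd))

/-- Modulo a multiple of `x`, [h, x] lies in ⟨h⟩ + ⟨x^[p]⟩, which centralizes `t`; it also has
eigenvalue c ≠ 0, so the remainder vanishes. -/
theorem exists_lie_eq_smul
    (hQ : ∀ x y : L, ∃ u ∈ R.cyclic x, ∃ v ∈ R.cyclic y, ⁅x, y⁆ = u + v) {t h x : L} {c : F}
    (hc : c ≠ 0) (hh : ⁅t, h⁆ = 0) (hx : ⁅t, x⁆ = c • x) : ∃ a : F, ⁅h, x⁆ = a • x := by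
  obtain ⟨u, hu, v, hv, hhx⟩ := hQ h x
  obtain ⟨a, v', hv', rfl⟩ := R.exists_of_mem_cyclic hv
  refine ⟨a, ?_⟩
  have hz : ⁅h, x⁆ - a • x = u + v' := by rw [hhx]; abel
  have h1 : ⁅t, u + v'⁆ = 0 := by
    rw [lie_add, R.lie_eq_zero_of_mem_cyclic_toFun hx hv',
      lie_eq_zero_comm (R.cyclic_lie_eq_zero (lie_eq_zero_comm hh) hu), add_zero]
  have h2 : ⁅t, ⁅h, x⁆ - a • x⁆ = c • (⁅h, x⁆ - a • x) := by
    rw [lie_sub, leibniz_lie, hh, zero_lie, zero_add, hx, lie_smul, lie_smul, hx]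
    module
  rw [← hz, h2] at h1
  exact sub_eq_zero.mp ((smul_eq_zero.mp h1).resolve_left hc)

theorem lie_eq_zero_of_eigen
    (hQ : ∀ x y : L, ∃ u ∈ R.cyclic x, ∃ v ∈ R.cyclic y, ⁅x, y⁆ = u + v) {t x y : L} {c d : F}
    (hc : c ≠ 0) (hd : d ≠ 0) (hcd : c + d ≠ 0) (hx : ⁅t, x⁆ = c • x) (hy : ⁅t, y⁆ = d • y) :
    ⁅x, y⁆ = 0 := by
  obtain ⟨u, hu, v, hv, hxy⟩ := hQ x y
  obtain ⟨a, u', hu', rfl⟩ := R.exists_of_mem_cyclic hu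
  obtain ⟨b, v', hv', rfl⟩ := R.exists_of_mem_cyclic hv
  have h0 : ⁅t, ⁅x, y⁆⁆ = (c + d) • ⁅x, y⁆ := by
    rw [leibniz_lie, hx, hy, smul_lie, lie_smul, add_smul]
  have h1 : (c + d) • ⁅x, y⁆ = (a * c) • x + (b * d) • y := by
    rw [← h0, hxy]
    simp only [lie_add, lie_smul, hx, hy, R.lie_eq_zero_of_mem_cyclic_toFun hx hu',
      R.lie_eq_zero_of_mem_cyclic_toFun hy hv', add_zero, smul_smul]
  have h2 := congrArg (⁅t, ·⁆) h1
  simp only [lie_smul, lie_add, h0, hx, hy] at h2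
  have h3 := congrArg (⁅t, ·⁆) h2
  simp only [lie_smul, lie_add, h0, hx, hy] at h3
  -- Applying (T - c)(T - d), with T = ad t, annihilates the right side and multiplies the left by c
  -- d, since its eigenvalue is c + d.
  have h4 : (c * d * (c + d)) • ⁅x, y⁆ = 0 := by
    linear_combination (norm := module) h3 - (c + d) • h2 + (c * d) • h1
  exact (smul_eq_zero.mp h4).resolve_left (mul_ne_zero (mul_ne_zero hc hd) hcd)

/-- Under the quasi-ideal condition, a toral element has at most one nonzero eigenvalue. -/
theorem eq_zero_or_eq_zero_of_eigen (hp : p ≠ 2)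
    (hQ : ∀ x y : L, ∃ u ∈ R.cyclic x, ∃ v ∈ R.cyclic y, ⁅x, y⁆ = u + v) {t x y : L} {c d : F}
    (ht : R.toFun t = t) (hc : c ≠ 0) (hd : d ≠ 0) (hcd : c ≠ d) (hx : ⁅t, x⁆ = c • x)
    (hy : ⁅t, y⁆ = d • y) : x = 0 ∨ y = 0 := by
  have hp3 : 3 ≤ p := by have := (Fact.out : p.Prime).two_le; omega
  have hcomm : ⁅x, ⁅x, y⁆⁆ = 0 ∧ ⁅y, ⁅x, y⁆⁆ = 0 := by
    -- For opposite eigenvalues [x, y] centralizes `t`, so it acts on `x` and `y` by scalars; this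
    -- forces (ad x)³ y = (ad y)³ x = 0.
    by_cases h : c + d = 0
    · have h0 : ⁅t, ⁅x, y⁆⁆ = 0 := by
        rw [leibniz_lie, hx, hy, smul_lie, lie_smul, ← add_smul, h, zero_smul]
      obtain ⟨m, hm⟩ := R.exists_lie_eq_smul hQ hc h0 hx
      obtain ⟨n, hn⟩ := R.exists_lie_eq_smul hQ hd h0 hy
      have hm' : ⁅x, ⁅x, y⁆⁆ = -(m • x) := by rw [← lie_skew, hm]
      have hn' : ⁅y, ⁅x, y⁆⁆ = -(n • y) := by rw [← lie_skew, hn]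
      have hx1 : ⁅R.toFun x, y⁆ = 0 := R.toFun_lie_eq_zero_of_ad_pow hp3 (by
        simp [pow_succ, hm'])
      have hy1 : ⁅R.toFun y, x⁆ = 0 := R.toFun_lie_eq_zero_of_ad_pow hp3 (by
        simp only [pow_succ, pow_zero, one_mul, Module.End.mul_apply, LieAlgebra.ad_apply]
        rw [← lie_skew y x, lie_neg, hn']
        simp)
      obtain ⟨u, hu, v, hv, hxy⟩ := hQ x y
      obtain ⟨a, u', hu', rfl⟩ := R.exists_of_mem_cyclic hu
      obtain ⟨b, v', hv', rfl⟩ := R.exists_of_mem_cyclic hv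
      have hab : ⁅t, a • x + b • y⁆ = 0 := by
        rw [show a • x + b • y = ⁅x, y⁆ - u' - v' by rw [hxy]; abel, lie_sub, lie_sub, h0,
          R.lie_eq_zero_of_mem_cyclic_toFun hx hu', R.lie_eq_zero_of_mem_cyclic_toFun hy hv']
        simp
      have hax : ⁅t, a • x⁆ = c • a • x := by rw [lie_smul, hx, smul_comm]
      have hby : ⁅t, b • y⁆ = d • b • y := by rw [lie_smul, hy, smul_comm]
      rw [eq_zero_of_lie_add_eq_zero hc hcd hax hby hab,
        eq_zero_of_lie_add_eq_zero hd hcd.symm hby hax (by rwa [add_comm]), zero_add,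
        zero_add] at hxy
      rw [hxy, lie_add, lie_add]
      refine ⟨?_, ?_⟩
      · rw [R.cyclic_lie_cyclic (R.self_mem_cyclic x) (R.cyclic_toFun_le x hu'),
          lie_eq_zero_comm (R.cyclic_lie_eq_zero hy1 hv'), add_zero]
      · rw [R.cyclic_lie_cyclic (R.self_mem_cyclic y) (R.cyclic_toFun_le y hv'),
          lie_eq_zero_comm (R.cyclic_lie_eq_zero hx1 hu'), add_zero]
    · rw [R.lie_eq_zero_of_eigen hQ hc hd h hx hy]
      simp
  have hadd := R.toFun_add_of_lie_lie_eq_zero hp hcomm.1 hcomm.2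
  -- Since (x + y)^[p] centralizes `t`, the part of [t, x + y] outside that centralizer is a single
  -- multiple `f` of x + y, forcing (c - f)x = (d - f)y = 0.
  obtain ⟨u, hu, v, hv, htxy⟩ := hQ t (x + y)
  obtain ⟨e, rfl⟩ := R.cyclic_le_of_toFun_eq ht hu
  obtain ⟨f, v, hv', rfl⟩ := R.exists_of_mem_cyclic hv
  have hv0 : ⁅t, v⁆ = 0 := by
    refine lie_eq_zero_comm (R.cyclic_lie_eq_zero (lie_eq_zero_comm ?_) hv')
    rw [hadd, lie_add, R.lie_toFun_eq_zero_of_lie_eq_smul hx,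
      R.lie_toFun_eq_zero_of_lie_eq_smul hy, add_zero]
  have hsum : (c - f) • x + (d - f) • y = e • t + v := by
    rw [lie_add, hx, hy] at htxy
    calc (c - f) • x + (d - f) • y = c • x + d • y - f • (x + y) := by module
      _ = e • t + v := by rw [htxy]; abel
  have hsum0 : ⁅t, (c - f) • x + (d - f) • y⁆ = 0 := by
    rw [hsum, lie_add, hv0, lie_smul, lie_self, smul_zero, add_zero]
  have hcx : ⁅t, (c - f) • x⁆ = c • (c - f) • x := by rw [lie_smul, hx, smul_comm]
  have hdy : ⁅t, (d - f) • y⁆ = d • (d - f) • y := by rw [lie_smul, hy, smul_comm]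
  have h1 := eq_zero_of_lie_add_eq_zero hc hcd hcx hdy hsum0
  have h2 := eq_zero_of_lie_add_eq_zero hd hcd.symm hdy hcx (by rwa [add_comm])
  rw [smul_eq_zero] at h1 h2
  rcases h1 with h1 | h1
  · rcases h2 with h2 | h2
    · exact absurd ((sub_eq_zero.mp h1).trans (sub_eq_zero.mp h2).symm) hcd
    · exact Or.inr h2
  · exact Or.inl h1

theorem pow_eq_of_lie_eq_smul {t x : L} {c : F} (ht : R.toFun t = t) (hx0 : x ≠ 0)
    (hx : ⁅t, x⁆ = c • x) : c ^ p = c := by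
  have h : ∀ k : ℕ, (LieAlgebra.ad F L t ^ k) x = c ^ k • x := fun k => by
    induction k with
    | zero => simp
    | succ k ih =>
      rw [pow_succ', Module.End.mul_apply, ih, map_smul, LieAlgebra.ad_apply, hx, smul_smul,
        pow_succ]
  have h1 := h p
  rw [← R.toFun_lie, ht, hx] at h1
  exact (smul_left_injective F hx0 h1).symm

open Polynomial in
theorem iSup_eigenspace_ad_eq_top [IsAlgClosed F] [FiniteDimensional F L] {t : L}
    (ht : R.toFun t = t) : ⨆ c : F, (LieAlgebra.ad F L t).eigenspace c = ⊤ := by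
  have hss : (LieAlgebra.ad F L t).IsSemisimple := by
    refine Module.End.isSemisimple_of_squarefree_aeval_eq_zero (p := (X ^ p - X : F[X]))
      (galois_poly_separable p p dvd_rfl).squarefree ?_
    rw [map_sub, map_pow, aeval_X, ← R.ad_toFun, ht, sub_self]
  rw [← Module.End.iSup_maxGenEigenspace_eq_top (LieAlgebra.ad F L t)]
  exact iSup_congr fun c =>
    (hss.isFinitelySemisimple.maxGenEigenspace_eq_eigenspace c).symm

theorem exists_eigen_decomposition [IsAlgClosed F] [FiniteDimensional F L] (hp : p ≠ 2)
    (hQ : ∀ x y : L, ∃ u ∈ R.cyclic x, ∃ v ∈ R.cyclic y, ⁅x, y⁆ = u + v) {t : L}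
    (ht : R.toFun t = t) :
    ∃ c : F, c ≠ 0 ∧ c ^ p = c ∧
      ∀ x : L, ∃ x₀ x₁ : L, x = x₀ + x₁ ∧ ⁅t, x₀⁆ = 0 ∧ ⁅t, x₁⁆ = c • x₁ := by
  obtain ⟨c, hc0, hcp, hc⟩ : ∃ c : F, c ≠ 0 ∧ c ^ p = c ∧
      ∀ (d : F) (x : L), d ≠ 0 → d ≠ c → ⁅t, x⁆ = d • x → x = 0 := by
    by_cases h : ∃ c : F, c ≠ 0 ∧ ∃ x : L, x ≠ 0 ∧ ⁅t, x⁆ = c • x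
    · obtain ⟨c, hc, x, hx0, hx⟩ := h
      refine ⟨c, hc, R.pow_eq_of_lie_eq_smul ht hx0 hx, fun d y hd hdc hy => ?_⟩
      exact (R.eq_zero_or_eq_zero_of_eigen hp hQ ht hd hc hdc hy hx).resolve_right hx0
    · push Not at h
      -- With no nonzero eigenvalue, `t` is central and any nonzero element of the prime field
      -- serves.
      exact ⟨1, one_ne_zero, one_pow p, fun d x hd _ hx => by_contra fun hx0 => h d hd x hx0 hx⟩
  refine ⟨c, hc0, hcp, fun x => ?_⟩
  have hx : x ∈ (LieAlgebra.ad F L t).eigenspace 0 ⊔ (LieAlgebra.ad F L t).eigenspace c := by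
    refine (?_ : ⨆ d : F, (LieAlgebra.ad F L t).eigenspace d ≤ _)
      ((R.iSup_eigenspace_ad_eq_top ht).ge trivial)
    refine iSup_le fun d => ?_
    rcases eq_or_ne d 0 with rfl | hd
    · exact le_sup_left
    rcases eq_or_ne d c with rfl | hdc
    · exact le_sup_right
    intro y hy
    rw [hc d y hd hdc (by simpa using Module.End.mem_eigenspace_iff.mp hy)]
    exact zero_mem _
  obtain ⟨x₀, h₀, x₁, h₁, h⟩ := Submodule.mem_sup.mp hx
  exact ⟨x₀, x₁, h.symm, by simpa using Module.End.mem_eigenspace_iff.mp h₀,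
    by simpa using Module.End.mem_eigenspace_iff.mp h₁⟩

theorem toFun_smul_add_smul (hp : p ≠ 2) {t u : L} {a b : F} (ht : R.toFun t = t)
    (hu : R.toFun u = u) (h : ⁅t, u⁆ = 0) (ha : a ^ p = a) (hb : b ^ p = b) :
    R.toFun (a • t + b • u) = a • t + b • u := by
  rw [R.toFun_add_of_commute hp (by rw [smul_lie, lie_smul, h, smul_zero, smul_zero]),
    R.toFun_smul, R.toFun_smul, ht, hu, ha, hb]

/-- Under the quasi-ideal condition, there is a toral element with eigenvalues in `{0, 1}` such
that all toral elements of its centralizer are central in its centralizer. -/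
theorem exists_toral [IsAlgClosed F] [FiniteDimensional F L] (hp : p ≠ 2)
    (hQ : ∀ x y : L, ∃ u ∈ R.cyclic x, ∃ v ∈ R.cyclic y, ⁅x, y⁆ = u + v) :
    ∃ t : L, R.toFun t = t ∧
      (∀ x : L, ∃ x₀ x₁ : L, x = x₀ + x₁ ∧ ⁅t, x₀⁆ = 0 ∧ ⁅t, x₁⁆ = x₁) ∧
      ∀ u h : L, R.toFun u = u → ⁅t, u⁆ = 0 → ⁅t, h⁆ = 0 → ⁅u, h⁆ = 0 := by
  by_cases hcen : ∀ t x : L, R.toFun t = t → ⁅t, x⁆ = 0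
  · exact ⟨0, R.toFun_zero, fun x => ⟨x, 0, (add_zero x).symm, zero_lie x, lie_zero _⟩,
      fun u h hu _ _ => hcen u h hu⟩
  push Not at hcen
  obtain ⟨t, x, ht, hx⟩ := hcen
  obtain ⟨c, hc, hcp, hdec⟩ := R.exists_eigen_decomposition hp hQ ht
  have htc : R.toFun (c⁻¹ • t) = c⁻¹ • t := by rw [R.toFun_smul, ht, inv_pow, hcp]
  have hdec' : ∀ x : L, ∃ x₀ x₁ : L, x = x₀ + x₁ ∧ ⁅c⁻¹ • t, x₀⁆ = 0 ∧ ⁅c⁻¹ • t, x₁⁆ = x₁ :=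
    fun x => by
      obtain ⟨x₀, x₁, h, h₀, h₁⟩ := hdec x
      exact ⟨x₀, x₁, h, by rw [smul_lie, h₀, smul_zero],
        by rw [smul_lie, h₁, smul_smul, inv_mul_cancel₀ hc, one_smul]⟩
  obtain ⟨y, hy0, hy⟩ : ∃ y : L, y ≠ 0 ∧ ⁅c⁻¹ • t, y⁆ = y := by
    obtain ⟨x₀, y, h, h₀, h₁⟩ := hdec' x
    refine ⟨y, ?_, h₁⟩
    rintro rfl
    rw [add_zero] at h
    rw [← h, smul_lie, smul_eq_zero] at h₀
    exact hx (h₀.resolve_left (inv_ne_zero hc))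
  generalize c⁻¹ • t = t at htc hdec' hy
  refine ⟨t, htc, hdec', fun u h hu htu hth => by_contra fun huh => ?_⟩
  obtain ⟨a, ha⟩ := R.exists_lie_eq_smul hQ (one_ne_zero (α := F)) htu (by rw [hy, one_smul])
  have hap := R.pow_eq_of_lie_eq_smul hu hy0 ha
  have hodd := (Fact.out : p.Prime).odd_of_ne_two hp
  -- `v` is toral, acts on `h` as `u` does, and kills `y`.
  set v := (1 : F) • u + (-a) • t with hv
  have hvt : R.toFun v = v :=
    R.toFun_smul_add_smul hp hu htc (lie_eq_zero_comm htu) (one_pow p) (by rw [hodd.neg_pow, hap])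
  have hvy : ⁅v, y⁆ = 0 := by rw [hv, add_lie, smul_lie, smul_lie, ha, hy]; module
  have hvh : ⁅v, h⁆ = ⁅u, h⁆ := by rw [hv, add_lie, smul_lie, smul_lie, hth]; simp
  have htv : ⁅t, v⁆ = 0 := by rw [hv, lie_add, lie_smul, lie_smul, htu, lie_self]; simp
  obtain ⟨e, he, hep, hdecv⟩ := R.exists_eigen_decomposition hp hQ hvt
  obtain ⟨h₀, h₁, rfl, hh₀, hh₁⟩ := hdecv h
  rw [lie_add, hh₀, hh₁, zero_add] at hvh
  have hth₁ : ⁅t, h₁⁆ = 0 := by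
    have h2 : ⁅t, e • h₁⁆ = 0 := by
      rw [hvh, leibniz_lie, htu, zero_lie, hth, lie_zero, add_zero]
    rw [lie_smul, smul_eq_zero] at h2
    exact h2.resolve_left he
  have h2p : (2 : F) ^ p = 2 := by
    rw [← one_add_one_eq_two, add_pow_char, one_pow]
  have h20 : (2 : F) ≠ 0 := by
    have := (CharP.cast_eq_zero_iff F p 2).not.mpr fun h =>
      hp ((Nat.prime_dvd_prime_iff_eq Fact.out Nat.prime_two).mp h)
    exact_mod_cast this
  -- e⁻¹v + 2t is toral with eigenvalue 1 on `h₁` and 2 on `y`; these are distinct and nonzero as p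
  -- ≠ 2, which is impossible.
  have hw := R.toFun_smul_add_smul hp hvt htc (lie_eq_zero_comm htv)
    (a := e⁻¹) (b := 2) (by rw [inv_pow, hep]) h2p
  rcases R.eq_zero_or_eq_zero_of_eigen hp hQ (x := h₁) (y := y) (c := 1) (d := 2) hw one_ne_zero h20
    (by rw [← one_add_one_eq_two]; simp)
    (by rw [add_lie, smul_lie, smul_lie, hh₁, hth₁, smul_smul, inv_mul_cancel₀ he]; simp)
    (by rw [add_lie, smul_lie, smul_lie, hvy, hy]; simp) with h | h
  · exact huh (hvh.symm.trans (by rw [h, smul_zero]))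
  · exact hy0 h

end PMapping

/-! ### Tori, nilpotency and the eigenvalue-1 space -/

namespace PMapping

variable {p : ℕ} {F L : Type*} [Fact p.Prime] [Field F] [CharP F p] [LieRing L] [LieAlgebra F L]
  (R : PMapping p F L)

/-- A `p`-nilpotent linear combination of commuting toral elements is zero. -/
theorem eq_zero_of_mem_span_toral (hp : p ≠ 2) {A : Set L} (hA : ∀ a ∈ A, ∀ b ∈ A, ⁅a, b⁆ = 0)
    (hR : ∀ a ∈ A, R.toFun a = a) {s : L} (hs : s ∈ Submodule.span F A) {k : ℕ}
    (hk : R.toFun^[k] s = 0) : s = 0 := by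
  set K := LieSubalgebra.spanOfCommute F A hA
  have hK : R.IsRestricted K := fun x hx =>
    R.toFun_mem_span hp hA (fun a ha => by rw [hR a ha]; exact Submodule.subset_span ha) hx
  have hab : ∀ v ∈ K, ∀ w ∈ K, ⁅v, w⁆ = 0 := fun v hv w hw =>
    lie_eq_zero_of_mem_span_of_mem_span hA hv hw
  have hle : Submodule.span F A ≤ (Submodule.span F {t | R.restrictHom hp K hK hab t = t}).map
      K.toSubmodule.subtype := by
    rw [Submodule.span_le]
    exact fun a ha => ⟨⟨a, Submodule.subset_span ha⟩,
      Submodule.subset_span (Subtype.ext (hR a ha)), rfl⟩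
  obtain ⟨z, hz, rfl⟩ := hle hs
  have h0 : (R.restrictHom hp K hK hab)^[k] z = 0 :=
    Subtype.ext ((R.coe_iterate_restrictHom hp K hK hab k z).trans hk)
  rw [eq_zero_of_iterate_eq_zero (R.restrictHom_smul hp K hK hab) hz h0, map_zero]

theorem lie_eq_zero_of_nil {x n : L} {a : F} (hn : ∃ k, R.toFun^[k] n = 0)
    (h : ⁅n, x⁆ = a • x) : ⁅n, x⁆ = 0 := by
  obtain ⟨k, hk⟩ := hn
  have h1 := apply_apply_eq_zero_of_pow_apply_eq_zero (A := LieAlgebra.ad F L n) (w := x) (b := a)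
    (z := 0) (R.ad_pow_eq_zero hk) (by simpa using h) (map_zero _)
  rw [LieAlgebra.ad_apply, LieAlgebra.ad_apply, h, lie_smul, h, smul_smul, smul_eq_zero,
    mul_self_eq_zero] at h1
  rw [h]
  rcases h1 with h1 | h1 <;> simp [h1]

theorem mem_closure {A : Set L} {x : L} :
    x ∈ R.closure A ↔ ∀ K : LieSubalgebra F L, R.IsRestricted K → A ⊆ K → x ∈ K := by
  rw [closure, ← SetLike.mem_coe, LieSubalgebra.coe_sInf, Set.mem_iInter₂]
  exact ⟨fun h K hK hA => h K ⟨hK, hA⟩, fun h K hK => h K hK.1 hK.2⟩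

theorem cyclic_le_closure (x : L) : R.cyclic x ≤ R.closure {x} := fun _ hw =>
  R.mem_closure.mpr fun _ hK hx => R.cyclic_le hK (hx rfl) hw

/-- The centralizer of an element. -/
def centralizer (t : L) : LieSubalgebra F L where
  carrier := {x | ⁅t, x⁆ = 0}
  zero_mem' := lie_zero t
  add_mem' {x y} hx hy := by
    change ⁅t, x + y⁆ = 0
    rw [lie_add, hx, hy, add_zero]
  smul_mem' a x hx := by
    change ⁅t, a • x⁆ = 0
    rw [lie_smul, hx, smul_zero]
  lie_mem' {x y} hx hy := by
    change ⁅t, ⁅x, y⁆⁆ = 0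
    rw [leibniz_lie, hx, hy, zero_lie, lie_zero, add_zero]

theorem isRestricted_centralizer (t : L) : R.IsRestricted (centralizer (F := F) t) := fun _ hx =>
  lie_eq_zero_comm (R.toFun_lie_eq_zero (lie_eq_zero_comm hx))

theorem isPNilpotent_iff {x : L} : R.IsPNilpotent x ↔ ∃ k, R.toFun^[k] x = 0 :=
  ⟨fun ⟨k, _, hk⟩ => ⟨k, hk⟩, fun ⟨k, hk⟩ =>
    ⟨k + 1, k.succ_pos, iterate_eq_zero_of_le R.toFun_zero k.le_succ hk⟩⟩

/-- Engel's theorem: each `x` acts on `H` as a `p`-nilpotent element, hence nilpotently. -/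
theorem isNilpotent_of_jordan [FiniteDimensional F L] (H : LieSubalgebra F L)
    (hH : ∀ x ∈ H, ∃ n ∈ H, (∃ k, R.toFun^[k] n = 0) ∧ ∀ h ∈ H, ⁅x, h⁆ = ⁅n, h⁆) :
    LieRing.IsNilpotent H := by
  rw [LieAlgebra.isNilpotent_iff_forall (R := F)]
  rintro ⟨x, hx⟩
  obtain ⟨n, hn, ⟨k, hk⟩, hxn⟩ := hH x hx
  have hpow : ∀ (j : ℕ) (h : H),
      (((LieAlgebra.ad F H ⟨x, hx⟩ ^ j) h : H) : L) = (LieAlgebra.ad F L n ^ j) h := fun j h => by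
    induction j with
    | zero => simp
    | succ j ih =>
      rw [pow_succ', pow_succ', Module.End.mul_apply, Module.End.mul_apply, ← ih]
      exact hxn _ (Subtype.prop _)
  refine ⟨p ^ k, LinearMap.ext fun h => Subtype.ext ?_⟩
  rw [hpow, R.ad_pow_eq_zero hk]
  rfl

/-- The nilpotent Jordan part lies in the toral span, so is zero. The remaining toral constituents,
being their own `p`-th powers, lie in ⟨x^[p]⟩. -/
theorem isTorus_spanOfCommute [IsAlgClosed F] [FiniteDimensional F L] (hp : p ≠ 2) {A : Set L}
    (hA : ∀ a ∈ A, ∀ b ∈ A, ⁅a, b⁆ = 0) (hR : ∀ a ∈ A, R.toFun a = a) :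
    R.IsTorus (LieSubalgebra.spanOfCommute F A hA) := by
  have hrestr : R.IsRestricted (LieSubalgebra.spanOfCommute F A hA) := fun x hx =>
    R.toFun_mem_span hp hA (fun a ha => by rw [hR a ha]; exact Submodule.subset_span ha) hx
  refine ⟨hrestr, ⟨fun x y => Subtype.ext (lie_eq_zero_of_mem_span_of_mem_span hA x.2 y.2)⟩,
    fun x hx => ?_⟩
  obtain ⟨s, hs, n, hn, ⟨k, hk⟩, hsn⟩ := R.exists_jordan hp x
  have hn0 : n = 0 := R.eq_zero_of_mem_span_toral hp hA hR (R.cyclic_le hrestr hx hn) hk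
  rw [hn0, add_zero] at hsn
  subst hsn
  refine (Submodule.span_le (p := (R.closure {R.toFun s}).toSubmodule)).mpr ?_ hs
  rintro t ⟨ht, htt⟩
  apply R.cyclic_le_closure
  rw [← htt]
  exact R.toFun_mem_cyclic_toFun hp ht

theorem exists_iterate_eq_zero_of_lie_eq_self [IsAlgClosed F] [FiniteDimensional F L] (hp : p ≠ 2)
    (hQ : ∀ x y : L, ∃ u ∈ R.cyclic x, ∃ v ∈ R.cyclic y, ⁅x, y⁆ = u + v) {t x : L}
    (ht : R.toFun t = t)
    (hcen : ∀ u h : L, R.toFun u = u → ⁅t, u⁆ = 0 → ⁅t, h⁆ = 0 → ⁅u, h⁆ = 0) (hx : ⁅t, x⁆ = x) :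
    ∃ k, R.toFun^[k] x = 0 := by
  obtain ⟨s, hs, n, hn, ⟨k, hk⟩, hsn⟩ := R.exists_jordan hp x
  have hx1 : ⁅t, x⁆ = (1 : F) • x := by rw [hx, one_smul]
  have hsA : s ∈ Submodule.span F {u | R.toFun u = u ∧ ⁅t, u⁆ = 0} := by
    refine Submodule.span_mono ?_ hs
    rintro u ⟨hu, huu⟩
    refine ⟨huu, R.lie_eq_zero_of_mem_cyclic_toFun hx1 ?_⟩
    rw [← huu]
    exact R.toFun_mem_cyclic_toFun hp hu
  have hts : ⁅t, s⁆ = 0 := lie_eq_zero_comm <|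
    lie_eq_zero_of_mem_span (fun a ha => lie_eq_zero_comm ha.2) hsA
  have hsx : ⁅s, x⁆ = 0 := lie_eq_zero_of_mem_span (fun a ha =>
    R.cyclic_lie_cyclic ha.1 (R.self_mem_cyclic x)) hs
  obtain ⟨u, hu, n', hn', h⟩ := hQ t n
  obtain ⟨a, rfl⟩ := R.cyclic_le_of_toFun_eq ht hu
  have htn : ⁅t, n⁆ = x := by
    rw [← zero_add ⁅t, n⁆, ← hts, ← lie_add, hsn, hx]
  -- From s + n = x = [t, n] = a t + n', the element s - a t is both a combination of commuting
  -- toral elements and `p`-nilpotent, so s = a t; as `s` commutes with `x`, a x = 0.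
  obtain ⟨b, n'', hn'', rfl⟩ : ∃ b : F, ∃ n'' ∈ R.cyclic n, n'' = s - b • t := by
    refine ⟨a, n' - n, sub_mem hn' (R.self_mem_cyclic n), ?_⟩
    rw [htn, ← hsn] at h
    rw [sub_eq_sub_iff_add_eq_add, h, add_comm]
  have h0 : s - b • t = 0 := by
    refine R.eq_zero_of_mem_span_toral hp (A := {u | R.toFun u = u ∧ ⁅t, u⁆ = 0})
      (fun u hu v hv => hcen u v hu.1 hu.2 hv.2) (fun u hu => hu.1) (sub_mem hsA ?_)
      (R.exists_iterate_eq_zero_of_mem_cyclic hp hk hn'')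
    exact Submodule.smul_mem _ _ (Submodule.subset_span ⟨ht, lie_self t⟩)
  rw [sub_eq_zero] at h0
  rw [h0, smul_lie, hx] at hsx
  rcases smul_eq_zero.mp hsx with hb | hx0
  · rw [hb, zero_smul] at h0
    rw [h0, zero_add] at hsn
    exact ⟨k, by rw [← hsn, hk]⟩
  · exact ⟨0, hx0⟩

end PMapping

/-! ### Assembling the decomposition -/

theorem mainTheorem12 {p : ℕ} {F L : Type*} [Fact p.Prime] [Field F] [IsAlgClosed F] [CharP F p]
    [LieRing L] [LieAlgebra F L] [FiniteDimensional F L] (hp : p ≠ 2) (R : PMapping p F L)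
    (hL : ∀ K : LieSubalgebra F L, R.IsRestricted K → R.IsRestrictedQuasiIdeal K) :
    ∃ H S P : LieSubalgebra F L, ∃ N : LieIdeal F L,
      H.IsCartanSubalgebra ∧
      -- `S` is a torus and `P` is the set of `p`-nilpotent elements of `H`
      R.IsTorus S ∧
      (∀ x : L, x ∈ P ↔ x ∈ H ∧ R.IsPNilpotent x) ∧
      -- `H = S ⊕ P` as algebras
      S.toSubmodule ⊔ P.toSubmodule = H.toSubmodule ∧
      Disjoint S.toSubmodule P.toSubmodule ∧
      (∀ s ∈ S, ∀ x ∈ P, ⁅s, x⁆ = 0) ∧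
      -- `L = S ∔ N` as vector spaces, with `N` a restricted ideal
      IsCompl S.toSubmodule N.toSubmodule ∧
      (∀ x ∈ N, R.toFun x ∈ N) ∧
      -- `N ^ 3 = 0` and `N^[p] ⊆ Z(H)`
      ⁅⁅N, N⁆, N⁆ = ⊥ ∧
      (∀ z ∈ R.pPower (N : Set L), ∃ hz : z ∈ H, (⟨z, hz⟩ : H) ∈ LieAlgebra.center F H) := by
  have hQ := R.exists_lie_eq_add hp hL
  obtain ⟨t, ht, hdec, hcen⟩ := R.exists_toral hp hQ
  set A : Set L := {u | R.toFun u = u ∧ ⁅t, u⁆ = 0} with hAdef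
  have hA : ∀ a ∈ A, ∀ b ∈ A, ⁅a, b⁆ = 0 := fun a ha b hb => hcen a b ha.1 ha.2 hb.2
  have hAR : ∀ a ∈ A, R.toFun a = a := fun a ha => ha.1
  set H : LieSubalgebra F L := PMapping.centralizer t
  set S : LieSubalgebra F L := LieSubalgebra.spanOfCommute F A hA
  set M : LieSubalgebra F L := R.nilSubalgebra hp hQ
  have hHR : R.IsRestricted H := R.isRestricted_centralizer t
  have htH : t ∈ H := lie_self t
  have hSH : ∀ s ∈ S, s ∈ H := fun s hs =>
    Submodule.span_le (p := H.toSubmodule) |>.mpr (fun u hu => hu.2) hs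
  have hScomm : ∀ s ∈ S, ∀ h ∈ H, ⁅s, h⁆ = 0 := fun s hs h hh =>
    lie_eq_zero_of_mem_span (F := F) (fun u hu => hcen u h hu.1 hu.2 hh) hs
  have hSM : ∀ s ∈ S, s ∈ M → s = 0 := fun s hs hk => by
    obtain ⟨k, hk⟩ := hk
    exact R.eq_zero_of_mem_span_toral hp hA hAR hs hk
  have hjordan : ∀ x ∈ H, ∃ s ∈ S, ∃ n ∈ H, n ∈ M ∧ s + n = x := fun x hx => by
    obtain ⟨s, hs, n, hn, hk, hsn⟩ := R.exists_jordan hp x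
    have hs' : s ∈ Submodule.span F A := by
      refine Submodule.span_mono ?_ hs
      exact fun u hu => ⟨hu.2, R.cyclic_le hHR hx hu.1⟩
    exact ⟨s, hs', n,
      R.cyclic_le hHR hx hn, hk, hsn⟩
  have hE : ∀ x, ⁅t, x⁆ = x → x ∈ M := fun x hx =>
    R.exists_iterate_eq_zero_of_lie_eq_self hp hQ ht hcen hx
  have hHE : ∀ h ∈ H, ∀ x, ⁅t, x⁆ = x → ∃ a : F, ⁅h, x⁆ = a • x := fun h hh x hx =>
    R.exists_lie_eq_smul hQ one_ne_zero hh (by rw [hx, one_smul])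
  have hMdec : ∀ n ∈ M, ∃ n₀ ∈ H, n₀ ∈ M ∧ ∃ n₁, ⁅t, n₁⁆ = n₁ ∧ n = n₀ + n₁ := fun n hn => by
    obtain ⟨n₀, n₁, h, h₀, h₁⟩ := hdec n
    refine ⟨n₀, h₀, ?_, n₁, h₁, h⟩
    rw [show n₀ = n - n₁ by rw [h, add_sub_cancel_right]]
    exact sub_mem hn (hE n₁ h₁)
  have hSMM : ∀ s ∈ S, ∀ n ∈ M, ⁅s, n⁆ ∈ M := fun s hs n hn => by
    obtain ⟨n₀, h₀, -, n₁, h₁, rfl⟩ := hMdec n hn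
    obtain ⟨a, ha⟩ := hHE s (hSH s hs) n₁ h₁
    rw [lie_add, hScomm s hs n₀ h₀, ha, zero_add]
    exact M.smul_mem a (hE n₁ h₁)
  have hsum : ∀ x : L, ∃ s ∈ S, ∃ n ∈ M, s + n = x := fun x => by
    obtain ⟨x₀, x₁, rfl, h₀, h₁⟩ := hdec x
    obtain ⟨s, hs, n, -, hn, rfl⟩ := hjordan x₀ h₀
    exact ⟨s, hs, n + x₁, M.add_mem hn (hE x₁ h₁), (add_assoc s n x₁).symm⟩
  have hMR : ∀ x ∈ M, R.toFun x ∈ M := fun x hx => R.exists_iterate_toFun_eq_zero hx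
  -- The scalar by which the nilpotent `n₀` acts on `n₁` is zero or `n₁` is, so they commute and
  -- their `p`-th powers add.
  have hMH : ∀ x ∈ M, R.toFun x ∈ H := fun x hx => by
    obtain ⟨n₀, h₀, hn₀, n₁, h₁, rfl⟩ := hMdec x hx
    obtain ⟨a, ha⟩ := hHE n₀ h₀ n₁ h₁
    rw [R.toFun_add_of_commute hp (R.lie_eq_zero_of_nil hn₀ ha)]
    exact add_mem (hHR n₀ h₀)
      (R.lie_toFun_eq_zero_of_lie_eq_smul (c := 1) (by rw [h₁, one_smul]))
  have hMZ : ∀ x ∈ M, ∀ h ∈ H, ⁅R.toFun x, h⁆ = 0 := fun x hx h hh => by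
    obtain ⟨s, hs, n, -, ⟨m, hm⟩, rfl⟩ := hjordan h hh
    obtain ⟨k, hk⟩ := hx
    rw [lie_add, lie_eq_zero_comm (hScomm s hs _ (hMH x ⟨k, hk⟩)),
      (R.lie_of_iterate_eq_zero hp hQ hk hm).1, add_zero]
  let N : LieIdeal F L :=
    { M.toSubmodule with
      lie_mem := fun {x n} hn => by
        obtain ⟨s, hs, m, hm, rfl⟩ := hsum x
        rw [add_lie]
        exact M.add_mem (hSMM s hs n hn) (M.lie_mem hm hn) }
  have hNM : ∀ x, x ∈ N ↔ x ∈ M := fun x => Iff.rfl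
  refine ⟨H, S, M ⊓ H, N, ⟨?_, ?_⟩, R.isTorus_spanOfCommute hp hA hAR, ?_, ?_, ?_, ?_, ⟨?_, ?_⟩,
    hMR, ?_, ?_⟩
  · refine R.isNilpotent_of_jordan H fun x hx => ?_
    obtain ⟨s, hs, n, hnH, hn, rfl⟩ := hjordan x hx
    exact ⟨n, hnH, hn, fun h hh => by rw [add_lie, hScomm s hs h hh, zero_add]⟩
  · refine le_antisymm (fun x hx => ?_) H.le_normalizer
    -- As `t` lies in `H`, a normalizing `x` has [t, x] in the centralizer of `t`; its eigenvalue-1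
    -- component must vanish.
    have h1 : ⁅t, ⁅t, x⁆⁆ = 0 := (LieSubalgebra.mem_normalizer_iff' H x).mp hx t htH
    obtain ⟨x₀, x₁, rfl, h₀, h₁⟩ := hdec x
    rw [lie_add, h₀, h₁, zero_add, h₁] at h1
    rw [h1, add_zero]
    exact h₀
  · intro x
    rw [R.isPNilpotent_iff]
    exact and_comm
  · refine le_antisymm (sup_le hSH fun x hx => hx.2) fun x hx => ?_
    obtain ⟨s, hs, n, hnH, hn, rfl⟩ := hjordan x hx
    exact Submodule.add_mem_sup hs ⟨hn, hnH⟩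
  · exact Submodule.disjoint_def.mpr fun x hx hx' => hSM x hx hx'.1
  · exact fun s hs x hx => hScomm s hs x hx.2
  · exact Submodule.disjoint_def.mpr fun x hx hx' => hSM x hx hx'
  · refine codisjoint_iff_le_sup.mpr fun x _ => ?_
    obtain ⟨s, hs, n, hn, rfl⟩ := hsum x
    exact Submodule.add_mem_sup hs hn
  · rw [LieSubmodule.lie_eq_bot_iff]
    intro w hw z hz
    rw [← LieSubmodule.mem_toSubmodule, LieSubmodule.lieIdeal_oper_eq_linear_span'] at hw
    refine lie_eq_zero_of_mem_span ?_ hw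
    rintro _ ⟨x, hx, y, hy, rfl⟩
    exact R.lie_lie_eq_zero_of_nil hp hQ hx hy hz
  · intro z hz
    -- The centre of `H`, viewed in `L`, is restricted, so minimality of the generated subalgebra
    -- reduces the claim to single `p`-th powers.
    let Z : LieSubalgebra F L :=
      { carrier := {z | z ∈ H ∧ ∀ h ∈ H, ⁅z, h⁆ = 0}
        zero_mem' := ⟨zero_mem H, fun h _ => zero_lie h⟩
        add_mem' := fun hx hy => ⟨add_mem hx.1 hy.1, fun h hh => by
          rw [add_lie, hx.2 h hh, hy.2 h hh, add_zero]⟩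
        smul_mem' := fun a x hx => ⟨H.smul_mem a hx.1, fun h hh => by
          rw [smul_lie, hx.2 h hh, smul_zero]⟩
        lie_mem' := fun {x y} hx hy => by
          change ⁅x, y⁆ ∈ H ∧ ∀ h ∈ H, ⁅⁅x, y⁆, h⁆ = 0
          rw [hx.2 y hy.1]
          exact ⟨zero_mem H, fun h _ => zero_lie h⟩ }
    have hZ : z ∈ Z := R.mem_closure.mp hz Z
      (fun x hx => ⟨hHR x hx.1, fun h hh => R.toFun_lie_eq_zero (hx.2 h hh)⟩) (by
        rintro _ ⟨x, hx, rfl⟩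
        exact ⟨hMH x hx, hMZ x hx⟩)
    refine ⟨hZ.1, (LieModule.mem_maxTrivSubmodule _ _ _ _).mpr fun h => Subtype.ext ?_⟩
    exact lie_eq_zero_comm (hZ.2 h h.2)
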